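/- A \emph{complexon} is a Borel measurable function $W:\bigsqcup_{d\ge 1}[0,1]^{d+1}\to[0,1]$ whose restriction to each cube $[0,1]^{d+1}$ is symmetric in its coordinates; by convention $W=1$ on $[0,1]$ and on the empty tuple. Let $\mathcal{W}$ be the set of all complexons. For $W\in\mathcal{W}$, the faceted complexon $\partial W$ is given by $\partial W(x_1,\dots,x_{d+1})=\prod_{\sigma\subseteq[d+1]}W(x_\sigma)$, where $x_\sigma$ is the tuple of the coordinates indexed by $\sigma$, and for a measure-preserving map $\phi:[0,1]\to[0,1]$ put $W^\phi(x_1,\dots,x_{d+1})=W(\phi(x_1),\dots,\phi(x_{d+1}))$. For a strictly positive, summable sequence $(\alpha_j)_{j\ge1}$ of real numbers and $U,W\in\mathcal{W}$ put $$\mathrm{d}_{\square,j}(U,W)=\sup_{S_1,\dots,S_{j+1}\in\mathcal{B}[0,1]}\left|\int_{S_1\times\cdots\times S_{j+1}}(U(x)-W(x))\,\mathrm{d}x\right|,$$ $$\mathrm{d}_\square(U,W)=\sum_{j\ge1}\alpha_j\,\mathrm{d}_{\square,j}(U,W),\qquad \delta_\square(U,W)=\inf_{\phi}\mathrm{d}_\square(U,W^\phi),$$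 where $\phi$ ranges over the measure-preserving maps $[0,1]\to[0,1]$. The \emph{canonical topology} on $\mathcal{W}$ is the topology determined by the pseudometric $\gamma(U,W)=\delta_\square(\partial U,\partial W)$: a set $O\subseteq\mathcal{W}$ is open if and only if for every $U\in O$ there is $\varepsilon>0$ such that every $W\in\mathcal{W}$ with $\gamma(U,W)<\varepsilon$ belongs to $O$. For a finite abstract simplicial complex $K$ with node set $[n]$, $n\ge1$, let $P_j=[(j-1)/n,j/n)$ for $j\in[n]$, and let $W_K$ be the complexon such that, for $d\ge1$, $W_K(x_1,\dots,x_{d+1})=1$ if there are distinct $j_1,\dots,j_{d+1}\in[n]$ with $\{j_1,\dots,j_{d+1}\}\in K$ and $x_\ell\in P_{j_\ell}$ for all $\ell$, and $W_K(x_1,\dots,x_{d+1})=0$ otherwise. \textbf{Proposition.} For every strictly positive, summable sequence $(\alpha_j)_{j\ge1}$, the set $\mathcal{W}_0=\{W_K : K \text{ a finite simplicial complex with node set } [n],\ n\ge 1\}$ is dense in $\mathcal{W}$ in the canonical topology. -/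

import Mathlib

open MeasureTheory

/-- A complexon: a totally symmetric Borel function with values in `[0,1]` on the disjoint union of
the cubes `[0,1]^k`. The dimension-`d` part of a complexon is its restriction to `[0,1]^(d+1)`, that
is `toFun (d + 1)`; the cubes that carry data are those with `k = d + 1 ≥ 2`, and the values on
`[0,1]` and on the empty tuple are `1` by convention. -/
structure Complexon where
  /-- The restriction of the complexon to `[0,1]^k`. -/
  toFun : (k : ℕ) → (Fin k → unitInterval) → ℝ
  measurable' : ∀ k, Measurable (toFun k)
  mem_Icc' : ∀ k x, toFun k x ∈ Set.Icc (0 : ℝ) 1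
  symm' : ∀ k (π : Equiv.Perm (Fin k)) x, toFun k (x ∘ π) = toFun k x
  eq_one' : ∀ k, k ≤ 1 → ∀ x, toFun k x = 1

namespace Complexon

/-- `W.onFace x σ` is the value `W(x_σ)`, where `x_σ` is the tuple of the coordinates of `x` indexed
by `σ`, listed in increasing order of the indices. -/
noncomputable def onFace (W : Complexon) {k : ℕ} (x : Fin k → unitInterval) (σ : Finset (Fin k)) : ℝ :=
  W.toFun σ.card (fun i => x (σ.orderEmbOfFin rfl i))

theorem toFun_congr (W : Complexon) {k l : ℕ} (e : Fin k ≃ Fin l) (f : Fin k → unitInterval) (g : Fin l → unitInterval)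
    (h : ∀ i, g (e i) = f i) : W.toFun k f = W.toFun l g := by
  obtain rfl : k = l := by simpa using Fintype.card_congr e
  have hf : f = g ∘ e := by
    funext i
    exact (h i).symm
  rw [hf]
  exact W.symm' k e g

theorem onFace_perm (W : Complexon) {k : ℕ} (x : Fin k → unitInterval) (π : Equiv.Perm (Fin k))
    (σ : Finset (Fin k)) : W.onFace (x ∘ π) σ = W.onFace x (σ.map π.toEmbedding) := by
  have hmem : ∀ i : Fin k, i ∈ σ ↔ π i ∈ σ.map π.toEmbedding := by
    intro i
    simp
  refine W.toFun_congr
    (((σ.orderIsoOfFin rfl).toEquiv.trans (π.subtypeEquiv hmem)).trans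
      ((σ.map π.toEmbedding).orderIsoOfFin rfl).symm.toEquiv) _ _ ?_
  intro i
  simp [← Finset.coe_orderIsoOfFin_apply]

/-- The faceted complexon `∂W`, with `∂W(x) = ∏_σ W(x_σ)` over all subsets `σ` of the index set. -/
noncomputable def faceted (W : Complexon) : Complexon where
  toFun k x := ∏ σ : Finset (Fin k), W.onFace x σ
  measurable' k := by
    refine Finset.measurable_prod _ fun σ _ => ?_
    exact (W.measurable' _).comp (measurable_pi_lambda _ fun i => measurable_pi_apply _)
  mem_Icc' k x :=
    ⟨Finset.prod_nonneg fun σ _ => (W.mem_Icc' _ _).1,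
      Finset.prod_le_one (fun σ _ => (W.mem_Icc' _ _).1) fun σ _ => (W.mem_Icc' _ _).2⟩
  symm' k π x := by
    simp only [onFace_perm]
    exact Fintype.prod_equiv (Equiv.finsetCongr π) _ _ fun σ => rfl
  eq_one' k hk x := by
    refine Finset.prod_eq_one fun σ _ => W.eq_one' _ ?_ _
    exact (Finset.card_le_univ σ).trans (by simpa using hk)

/-- The complexon `W^φ`, with `W^φ(x_1, …, x_k) = W(φ(x_1), …, φ(x_k))`. -/
def pullback (W : Complexon) (φ : unitInterval → unitInterval) (hφ : Measurable φ) : Complexon where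
  toFun k x := W.toFun k fun i => φ (x i)
  measurable' k := (W.measurable' k).comp
    (measurable_pi_lambda _ fun i => hφ.comp (measurable_pi_apply i))
  mem_Icc' k _ := W.mem_Icc' k _
  symm' k π x := W.symm' k π (fun i => φ (x i))
  eq_one' k hk _ := W.eq_one' k hk _

/-- The `d`-dimensional labeled cut-distance: the supremum, over Borel sets
`S_1, …, S_(d+1) ⊆ [0,1]`, of the absolute value of the integral of `U - W` over their product. -/
noncomputable def cutDistDim (d : ℕ) (U W : Complexon) : ℝ :=
  ⨆ S : {S : Fin (d + 1) → Set unitInterval // ∀ i, MeasurableSet (S i)},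
    |∫ x in Set.univ.pi S.1, (U.toFun (d + 1) x - W.toFun (d + 1) x)|

/-- The labeled cut-distance for the weights `α_1, α_2, …`, summed over the dimensions `j + 1 ≥ 1`.
The value `α 0` is not used. -/
noncomputable def cutDist (α : ℕ → ℝ) (U W : Complexon) : ℝ :=
  ∑' j : ℕ, α (j + 1) * cutDistDim (j + 1) U W

/-- The unlabeled cut-distance: the infimum of the labeled cut-distances between `U` and `W^φ` over
the measure-preserving transformations `φ` of `[0,1]`. -/
noncomputable def unlabeledCutDist (α : ℕ → ℝ) (U W : Complexon) : ℝ :=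
  ⨅ φ : {φ : unitInterval → unitInterval // MeasurePreserving φ volume volume},
    cutDist α U (W.pullback φ.1 φ.2.measurable)

/-- The pseudometric of the canonical topology: the unlabeled cut-distance of faceted complexons. -/
noncomputable def canonicalDist (α : ℕ → ℝ) (U W : Complexon) : ℝ :=
  unlabeledCutDist α U.faceted W.faceted

/-- The canonical topology: a set is open when it contains, with each of its points, an open ball of
`canonicalDist` around that point. -/
@[reducible] def canonicalTopology (α : ℕ → ℝ) : TopologicalSpace Complexon where
  IsOpen s := ∀ U ∈ s, ∃ ε > 0, ∀ W, canonicalDist α U W < ε → W ∈ s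
  isOpen_univ := fun _ _ => ⟨1, one_pos, fun _ _ => Set.mem_univ _⟩
  isOpen_inter := by
    rintro s t hs ht U ⟨hUs, hUt⟩
    obtain ⟨a, ha, has⟩ := hs U hUs
    obtain ⟨b, hb, hbt⟩ := ht U hUt
    exact ⟨min a b, lt_min ha hb, fun W hW =>
      ⟨has W (hW.trans_le (min_le_left _ _)), hbt W (hW.trans_le (min_le_right _ _))⟩⟩
  isOpen_sUnion := by
    rintro S hS U ⟨s, hsS, hUs⟩
    obtain ⟨ε, hε, h⟩ := hS s hsS U hUs
    exact ⟨ε, hε, fun W hW => ⟨s, hsS, h W hW⟩⟩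

/-- The interval `P_j = [j/n, (j+1)/n)`, for `j = 0, …, n - 1`. -/
def cell (n : ℕ) (j : Fin n) : Set unitInterval :=
  {t | (j : ℝ) / n ≤ (t : ℝ) ∧ (t : ℝ) < ((j : ℝ) + 1) / n}

theorem measurableSet_cell (n : ℕ) (j : Fin n) : MeasurableSet (cell n j) :=
  (measurableSet_le measurable_const measurable_subtype_coe).inter
    (measurableSet_lt measurable_subtype_coe measurable_const)

/-- The tuples `x ∈ [0,1]^k` that lie in a product of cells `P_(j_1) × ⋯ × P_(j_k)` for which
`j_1, …, j_k` are distinct nodes and `{j_1, …, j_k}` is a simplex of `K`. -/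
def simplexTuples {n : ℕ} (K : AbstractSimplicialComplex (Fin n)) (k : ℕ) : Set (Fin k → unitInterval) :=
  {x | ∃ j : Fin k → Fin n, Function.Injective j ∧ Finset.univ.image j ∈ K.faces ∧
    ∀ i, x i ∈ cell n (j i)}

theorem measurableSet_simplexTuples {n : ℕ} (K : AbstractSimplicialComplex (Fin n)) (k : ℕ) :
    MeasurableSet (simplexTuples K k) := by
  have h : simplexTuples K k = ⋃ j : {j : Fin k → Fin n //
      Function.Injective j ∧ Finset.univ.image j ∈ K.faces},
        Set.univ.pi fun i => cell n (j.1 i) := by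
    ext x
    simp [simplexTuples, and_assoc]
  rw [h]
  exact MeasurableSet.iUnion fun j =>
    MeasurableSet.univ_pi fun i => measurableSet_cell n (j.1 i)

theorem comp_mem_simplexTuples {n : ℕ} {K : AbstractSimplicialComplex (Fin n)} {k : ℕ}
    {x : Fin k → unitInterval} (hx : x ∈ simplexTuples K k) (π : Equiv.Perm (Fin k)) :
    x ∘ π ∈ simplexTuples K k := by
  classical
  obtain ⟨j, hj, hK, hc⟩ := hx
  refine ⟨j ∘ π, hj.comp π.injective, ?_, fun i => hc (π i)⟩
  have : Finset.univ.image (j ∘ π) = Finset.univ.image j := by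
    ext a
    simp only [Finset.mem_image, Finset.mem_univ, true_and, Function.comp_apply]
    exact π.exists_congr_left.trans (by simp)
  rwa [this]

open Classical in
/-- The complexon `W_K` of a finite simplicial complex `K` with node set `{0, …, n - 1}`. -/
noncomputable def ofComplex {n : ℕ} (K : AbstractSimplicialComplex (Fin n)) : Complexon where
  toFun k x := if k ≤ 1 ∨ x ∈ simplexTuples K k then 1 else 0
  measurable' k := by
    refine Measurable.ite ?_ measurable_const measurable_const
    exact (MeasurableSet.const (k ≤ 1)).union (measurableSet_simplexTuples K k)
  mem_Icc' k x := by
    split_ifs <;> simp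
  symm' k π x := by
    have h : x ∘ π ∈ simplexTuples K k ↔ x ∈ simplexTuples K k := by
      refine ⟨fun hx => ?_, fun hx => comp_mem_simplexTuples hx π⟩
      have := comp_mem_simplexTuples hx π⁻¹
      have e : (x ∘ π) ∘ (π⁻¹ : Equiv.Perm (Fin k)) = x := by
        funext i
        simp
      rwa [e] at this
    simp only [h]
  eq_one' k hk x := by
    simp [hk]

/-- The set `𝒲₀` of the complexons that arise from finite simplicial complexes. -/
def simplicial : Set Complexon :=
  {W | ∃ n : ℕ, 1 ≤ n ∧ ∃ K : AbstractSimplicialComplex (Fin n), W = ofComplex K}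

end Complexon

/-! Every complexon is approximated in the labeled cut-distance by a deterministic pseudorandom
complex, so no measure-preserving rearrangement is needed.

Replace `W` by a complexon continuous in every dimension, at small cost in `L¹`
(`exists_continuous_complexon`), and divide `[0,1]` into `m` intervals on which it is almost
constant. Over each interval put a block of vertices labeled by the vectors of `(ZMod q)^r`. A
vertex set `ρ` with at least two elements is accepted when the form `∑ j, ∏ u ∈ ρ, v u j` takes a
value below `q * W(x_ρ)`, which should happen with density about `W(x_ρ)`. A simplex of the complex
is a set all of whose subsets of size at least two are accepted. If the forms of the different
subsets behave independently, a tuple spans a simplex with density about `∏ W(x_σ)`, which is `∂W`;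
the complexon of a complex is its own faceted complexon, so this is the comparison required.

Independence must hold against every product of weights in the single vertices, because the
cut-distance tests on boxes `S_1 × ⋯ × S_k`. Fourier expansion on `ZMod q`
(`exists_abs_sum_form_sub_le`) reduces it to exponential sums of nontrivial combinations of forms.
Such a combination really couples two variables, so one Cauchy-Schwarz step removes the weights and
leaves a power saving in `r` (`sq_norm_sum_form_le`). Dimensions beyond a bound are absorbed by the
tail of `α`. -/

theorem sum_sum_update {ι V M : Type*} [Fintype ι] [DecidableEq ι] [Fintype V] [AddCommMonoid M]
    (b : ι) (F : (ι → V) → M) :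
    ∑ v : ι → V, ∑ y : V, F (Function.update v b y) = Fintype.card V • ∑ v, F v := by
  classical
  have h : ∑ p : (ι → V) × V, F (Function.update p.1 b p.2) = ∑ p : (ι → V) × V, F p.1 := by
    -- Exchanging the coordinate at `b` with the extra variable is an involution.
    refine Finset.sum_nbij' (fun p => (Function.update p.1 b p.2, p.1 b))
      (fun p => (Function.update p.1 b p.2, p.1 b)) ?_ ?_ ?_ ?_ ?_ <;> simp
  rw [Fintype.sum_prod_type, Fintype.sum_prod_type] at h
  rw [h]
  simp [Finset.smul_sum]

theorem addChar_sum {ι A M : Type*} [AddCommMonoid A] [CommMonoid M] (ψ : AddChar A M)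
    (s : Finset ι) (g : ι → A) : ψ (∑ i ∈ s, g i) = ∏ i ∈ s, ψ (g i) := by
  classical
  induction s using Finset.induction_on with
  | empty => simp
  | insert a s ha ih => rw [Finset.sum_insert ha, Finset.prod_insert ha, AddChar.map_add_eq_mul, ih]

/-! ### Exponential sums of multilinear forms over `ZMod q`. -/

section FormSums

variable {q r : ℕ} [Fact q.Prime] {ι : Type*} [Fintype ι] [DecidableEq ι]

/-- The multilinear form `∑ j, ∏ i ∈ σ, v i j` in the vectors `v i`, `i ∈ σ`. -/
def multiForm (σ : Finset ι) (v : ι → Fin r → ZMod q) : ZMod q := ∑ j, ∏ i ∈ σ, v i j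

/-- The multi-affine polynomial with coefficients `c`. -/
def multiAffine (c : Finset ι → ZMod q) (w : ι → ZMod q) : ZMod q := ∑ σ, c σ * ∏ i ∈ σ, w i

/-- The coefficient of `w a * w b` in `multiAffine c w`. -/
def mixedCoeff (c : Finset ι → ZMod q) (a b : ι) (w : ι → ZMod q) : ZMod q :=
  ∑ σ, if a ∈ σ ∧ b ∈ σ then c σ * ∏ i ∈ σ \ {a, b}, w i else 0

omit [DecidableEq ι] in
theorem sum_mul_multiForm (c : Finset ι → ZMod q) (v : ι → Fin r → ZMod q) :
    ∑ σ, c σ * multiForm σ v = ∑ j, multiAffine c (fun i => v i j) := by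
  simp only [multiForm, multiAffine, Finset.mul_sum]
  exact Finset.sum_comm

omit [Fintype ι] in
theorem prod_update_update {a b : ι} (hab : a ≠ b) (σ : Finset ι) (w : ι → ZMod q) (x y : ZMod q) :
    ∏ i ∈ σ, Function.update (Function.update w a x) b y i =
      (if a ∈ σ then x else 1) * (if b ∈ σ then y else 1) * ∏ i ∈ σ \ {a, b}, w i := by
  have h1 : ∀ i, Function.update (Function.update w a x) b y i =
      (if i = a then x else 1) * (if i = b then y else 1) *
        (if i ∈ ({a, b} : Finset ι) then 1 else w i) := by
    intro i
    by_cases hb : i = b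
    · subst hb; simp [hab.symm]
    · by_cases ha : i = a
      · subst ha; simp [hab]
      · simp [ha, hb]
  simp only [h1, Finset.prod_mul_distrib, Finset.prod_ite_eq']
  congr 1
  rw [Finset.prod_ite]
  simp [Finset.sdiff_eq_filter]

/-- The polynomial has degree at most one in each variable, so its difference in the variable `b` is
affine in the variable `a`; the slope comes from the monomials containing both. -/
theorem multiAffine_second_difference (c : Finset ι → ZMod q) {a b : ι} (hab : a ≠ b)
    (w : ι → ZMod q) (x y y' : ZMod q) :
    multiAffine c (Function.update (Function.update w a x) b y) -
      multiAffine c (Function.update (Function.update w a x) b y') =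
    (multiAffine c (Function.update (Function.update w a 0) b y) -
      multiAffine c (Function.update (Function.update w a 0) b y')) +
      x * ((y - y') * mixedCoeff c a b w) := by
  simp only [multiAffine, mixedCoeff, Finset.mul_sum, ← Finset.sum_sub_distrib,
    ← Finset.sum_add_distrib, prod_update_update hab]
  refine Finset.sum_congr rfl fun σ _ => ?_
  by_cases ha : a ∈ σ <;> by_cases hb : b ∈ σ <;> simp [ha, hb]; ring

/-- Evaluate at the indicator of a minimal `σ` containing `a` and `b` with `c σ ≠ 0`: sets not
inside `σ` meet a zero factor, and smaller ones have zero coefficient by minimality. -/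
theorem exists_mixedCoeff_ne_zero (c : Finset ι → ZMod q) {a b : ι} {σ₀ : Finset ι}
    (ha : a ∈ σ₀) (hb : b ∈ σ₀) (hc : c σ₀ ≠ 0) : ∃ w, mixedCoeff c a b w ≠ 0 := by
  classical
  obtain ⟨σ, hσ, hmin⟩ := (Finset.univ.filter fun σ : Finset ι => a ∈ σ ∧ b ∈ σ ∧ c σ ≠ 0).exists_minimal
    ⟨σ₀, by simp [ha, hb, hc]⟩
  simp only [Finset.mem_filter, Finset.mem_univ, true_and] at hσ hmin
  refine ⟨fun i => if i ∈ σ then 1 else 0, ?_⟩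
  have : mixedCoeff c a b (fun i => if i ∈ σ then 1 else 0) = c σ := by
    rw [mixedCoeff, Finset.sum_eq_single σ]
    · rw [if_pos ⟨hσ.1, hσ.2.1⟩, Finset.prod_eq_one, mul_one]
      intro i hi
      simp [(Finset.mem_sdiff.1 hi).1]
    · intro τ _ hτ
      split_ifs with h
      · by_cases hcτ : c τ = 0
        · simp [hcτ]
        by_cases hsub : τ ⊆ σ
        · exact absurd (subset_antisymm hsub (hmin ⟨h.1, h.2, hcτ⟩ hsub)) hτ
        · obtain ⟨i, hi, hiσ⟩ := Finset.not_subset.1 hsub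
          rw [Finset.prod_eq_zero (i := i), mul_zero]
          · simp only [Finset.mem_sdiff, hi, true_and, Finset.mem_insert, Finset.mem_singleton]
            rintro (rfl | rfl)
            · exact hiσ hσ.1
            · exact hiσ hσ.2.1
          · simp [hiσ]
      · rfl
    · simp
  rw [this]
  exact hσ.2.2

/-- The sum factors over the coordinates `j`, and orthogonality of characters applies to each
factor. -/
theorem norm_sum_addChar_linear {ψ : AddChar (ZMod q) ℂ} (hψ : ψ.IsPrimitive) (z : Fin r → ZMod q) (C : ZMod q) :
    ‖∑ x : Fin r → ZMod q, ψ (C + ∑ j, x j * z j)‖ =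
      if ∀ j, z j = 0 then (Fintype.card (Fin r → ZMod q) : ℝ) else 0 := by
  have h : ∑ x : Fin r → ZMod q, ψ (C + ∑ j, x j * z j) = ψ C * ∏ j, ∑ t : ZMod q, ψ (t * z j) := by
    rw [Finset.prod_univ_sum, Finset.mul_sum, Fintype.piFinset_univ]
    refine Finset.sum_congr rfl fun x _ => ?_
    rw [AddChar.map_add_eq_mul, addChar_sum]
  rw [h, norm_mul, AddChar.norm_apply, one_mul, norm_prod]
  simp only [AddChar.sum_mulShift _ hψ]
  split_ifs with hz
  · simp [hz, ZMod.card]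
  · push Not at hz
    obtain ⟨j, hj⟩ := hz
    exact Finset.prod_eq_zero (Finset.mem_univ j) (by simp [hj])

/-- The triples at which the second difference of a multi-affine polynomial does not depend on the
increment of its first argument. -/
def degenerateTriples (c : Finset ι → ZMod q) (a b : ι) : Finset ((ι → ZMod q) × ZMod q × ZMod q) :=
  Finset.univ.filter fun t => (t.2.1 - t.2.2) * mixedCoeff c a b t.1 = 0

/-- One nondegenerate triple is enough: the resulting proportion below `1` is later raised to the
power `r`. -/
theorem card_degenerateTriples_lt (c : Finset ι → ZMod q) {a b : ι} {σ₀ : Finset ι}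
    (ha : a ∈ σ₀) (hb : b ∈ σ₀) (hc : c σ₀ ≠ 0) :
    (degenerateTriples c a b).card + 1 ≤ q ^ (Fintype.card ι + 2) := by
  obtain ⟨w, hw⟩ := exists_mixedCoeff_ne_zero c ha hb hc
  have h : (degenerateTriples c a b).card < Fintype.card ((ι → ZMod q) × ZMod q × ZMod q) := by
    refine Finset.card_lt_univ_of_notMem (x := (w, 1, 0)) ?_
    simp [degenerateTriples, hw]
  simp only [Fintype.card_prod, Fintype.card_fun, ZMod.card] at h
  rw [pow_add, pow_two]
  exact h

/-- The condition is imposed on each coordinate `j` separately, so the count is an `r`-th power.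
This is the reason for using forms that are sums over coordinates. -/
theorem sum_degenerate (c : Finset ι → ZMod q) (a b : ι) :
    ∑ y : Fin r → ZMod q, ∑ y' : Fin r → ZMod q, ∑ v : ι → Fin r → ZMod q,
      (if ∀ j, (y j - y' j) * mixedCoeff c a b (fun i => v i j) = 0 then (1 : ℝ) else 0) =
      ((degenerateTriples c a b).card : ℝ) ^ r := by
  have h : ∑ p : (Fin r → ZMod q) × (Fin r → ZMod q) × (ι → Fin r → ZMod q),
      (if ∀ j, (p.1 j - p.2.1 j) * mixedCoeff c a b (fun i => p.2.2 i j) = 0 then (1 : ℝ) else 0) =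
      ((degenerateTriples c a b).card : ℝ) ^ r := by
    have e : ((degenerateTriples c a b).card : ℝ) ^ r =
        ∏ j : Fin r, ∑ t : (ι → ZMod q) × ZMod q × ZMod q,
          if (t.2.1 - t.2.2) * mixedCoeff c a b t.1 = 0 then (1 : ℝ) else 0 := by
      simp [degenerateTriples, Finset.sum_boole]
    rw [e, Finset.prod_univ_sum, Fintype.piFinset_univ]
    refine Finset.sum_nbij' (fun p j => (fun i => p.2.2 i j, p.1 j, p.2.1 j))
      (fun s => (fun j => (s j).2.1, fun j => (s j).2.2, fun i j => (s j).1 i)) ?_ ?_ ?_ ?_ ?_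
    · simp
    · simp
    · simp
    · simp
    · intro p _
      rw [Finset.prod_ite_zero]
      simp
  rw [← h, Fintype.sum_prod_type]
  simp only [Fintype.sum_prod_type]

theorem sq_norm_sum_eq {V : Type*} [Fintype V] (z : V → ℂ) :
    ((‖∑ y, z y‖ ^ 2 : ℝ) : ℂ) = ∑ y, ∑ y', z y * (starRingEnd ℂ) (z y') := by
  rw [← Finset.sum_mul_sum, ← map_sum, Complex.mul_conj, Complex.normSq_eq_norm_sq]

/-- Isolating the variable `b` bounds all other weights by `1`, and Cauchy-Schwarz then leaves only
`f b` at two points `y`, `y'`. The phase difference is affine in the variable `a`, so summing over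
it cancels everything except where the slope vanishes in every coordinate. -/
theorem sq_norm_sum_form_le {ψ : AddChar (ZMod q) ℂ} (hψ : ψ.IsPrimitive)
    (c : Finset ι → ZMod q) {a b : ι} (hab : a ≠ b) (f : ι → (Fin r → ZMod q) → ℂ)
    (hf : ∀ i x, ‖f i x‖ ≤ 1) :
    (q ^ r : ℝ) ^ 2 * ‖∑ v : ι → Fin r → ZMod q, (∏ i, f i (v i)) * ψ (∑ σ, c σ * multiForm σ v)‖ ^ 2 ≤
      (q ^ r : ℝ) ^ Fintype.card ι * ((degenerateTriples c a b).card : ℝ) ^ r := by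
  have hcard : (Fintype.card (Fin r → ZMod q) : ℝ) = (q : ℝ) ^ r := by simp [ZMod.card]
  set Φ : (ι → Fin r → ZMod q) → ZMod q := fun v => ∑ σ, c σ * multiForm σ v with hΦ
  have hq0 : (0 : ℝ) < (q : ℝ) ^ r := by
    have : 0 < q := (Fact.out : q.Prime).pos
    positivity
  -- summation over the variable `b` first
  have h1 : (q ^ r : ℝ) * ‖∑ v, (∏ i, f i (v i)) * ψ (Φ v)‖ ≤
      ∑ v : ι → Fin r → ZMod q, ‖∑ y, f b y * ψ (Φ (Function.update v b y))‖ := by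
    have e := sum_sum_update (M := ℂ) b (fun v : ι → Fin r → ZMod q => (∏ i, f i (v i)) * ψ (Φ v))
    rw [nsmul_eq_mul] at e
    have e2 := congrArg norm e
    rw [norm_mul, Complex.norm_natCast, hcard] at e2
    rw [← e2]
    refine (norm_sum_le _ _).trans (Finset.sum_le_sum fun v _ => ?_)
    have e3 : ∀ y, (∏ i, f i (Function.update v b y i)) * ψ (Φ (Function.update v b y)) =
        (∏ i ∈ Finset.univ.erase b, f i (v i)) * (f b y * ψ (Φ (Function.update v b y))) := by
      intro y
      rw [← Finset.mul_prod_erase _ _ (Finset.mem_univ b), Function.update_self,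
        Finset.prod_congr rfl (g := fun i => f i (v i))]
      · ring
      · intro i hi
        rw [Function.update_of_ne (Finset.ne_of_mem_erase hi)]
    simp only [e3]
    rw [← Finset.mul_sum, norm_mul, norm_prod]
    exact mul_le_of_le_one_left (norm_nonneg _)
      (Finset.prod_le_one (fun _ _ => norm_nonneg _) fun i _ => hf _ _)
  have h2 : (∑ v : ι → Fin r → ZMod q, ‖∑ y, f b y * ψ (Φ (Function.update v b y))‖) ^ 2 ≤
      (q ^ r : ℝ) ^ Fintype.card ι *
        ∑ v : ι → Fin r → ZMod q, ‖∑ y, f b y * ψ (Φ (Function.update v b y))‖ ^ 2 := by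
    have := sq_sum_le_card_mul_sum_sq (s := (Finset.univ : Finset (ι → Fin r → ZMod q)))
      (f := fun v => ‖∑ y, f b y * ψ (Φ (Function.update v b y))‖)
    rw [Finset.card_univ, Fintype.card_fun, Nat.cast_pow, hcard] at this
    exact this
  -- summation over the variable `a`
  have h3 : ∀ y y'   : Fin r → ZMod q, ‖∑ v : ι → Fin r → ZMod q, ψ (Φ (Function.update v b y) - Φ (Function.update v b y'))‖ ≤
      ∑ v : ι → Fin r → ZMod q,
        if ∀ j, (y j - y' j) * mixedCoeff c a b (fun i => v i j) = 0 then (1 : ℝ) else 0 := by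
    intro y y'
    have e := sum_sum_update (M := ℂ) a
      (fun v : ι → Fin r → ZMod q => ψ (Φ (Function.update v b y) - Φ (Function.update v b y')))
    rw [nsmul_eq_mul] at e
    have e2 := congrArg norm e
    rw [norm_mul, Complex.norm_natCast, hcard] at e2
    refine le_of_mul_le_mul_left ?_ hq0
    rw [← e2, Finset.mul_sum]
    refine (norm_sum_le _ _).trans (Finset.sum_le_sum fun v _ => ?_)
    have e3 : ∀ x   : Fin r → ZMod q, Φ (Function.update (Function.update v a x) b y) -
        Φ (Function.update (Function.update v a x) b y') =
        (Φ (Function.update (Function.update v a 0) b y) -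
          Φ (Function.update (Function.update v a 0) b y')) +
          ∑ j, x j * ((y j - y' j) * mixedCoeff c a b (fun i => v i j)) := by
      intro x
      have hu : ∀ (x y   : Fin r → ZMod q) (j : Fin r),
          (fun i => Function.update (Function.update v a x) b y i j) =
          Function.update (Function.update (fun i => v i j) a (x j)) b (y j) := by
        intro x y j
        funext i
        by_cases hb : i = b
        · subst hb; simp
        · by_cases ha : i = a
          · subst ha; simp [hab]
          · simp [ha, hb]
      have hS : ∀ w, Φ w = ∑ j, multiAffine c (fun i => w i j) := sum_mul_multiForm c
      rw [hS, hS, hS, hS, ← Finset.sum_sub_distrib, ← Finset.sum_sub_distrib,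
        ← Finset.sum_add_distrib]
      refine Finset.sum_congr rfl fun j _ => ?_
      rw [hu, hu, hu, hu]
      exact multiAffine_second_difference c hab _ _ _ _
    refine (congrArg norm (Finset.sum_congr rfl fun x _ => congrArg ψ (e3 x))).trans_le ?_
    rw [norm_sum_addChar_linear hψ, hcard]
    split_ifs <;> simp
  have h4 : ∑ v : ι → Fin r → ZMod q, ‖∑ y, f b y * ψ (Φ (Function.update v b y))‖ ^ 2 ≤
      ((degenerateTriples c a b).card : ℝ) ^ r := by
    have e : ((∑ v : ι → Fin r → ZMod q, ‖∑ y, f b y * ψ (Φ (Function.update v b y))‖ ^ 2 : ℝ) : ℂ) =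
        ∑ y, ∑ y', (f b y * (starRingEnd ℂ) (f b y')) *
          ∑ v : ι → Fin r → ZMod q, ψ (Φ (Function.update v b y) - Φ (Function.update v b y')) := by
      rw [Complex.ofReal_sum]
      simp only [sq_norm_sum_eq, Finset.mul_sum]
      rw [Finset.sum_comm]
      refine Finset.sum_congr rfl fun y _ => ?_
      rw [Finset.sum_comm]
      refine Finset.sum_congr rfl fun y' _ => Finset.sum_congr rfl fun v _ => ?_
      rw [map_mul, ← AddChar.map_neg_eq_conj, sub_eq_add_neg, AddChar.map_add_eq_mul]
      ring
    have hnn : 0 ≤ ∑ v : ι → Fin r → ZMod q, ‖∑ y, f b y * ψ (Φ (Function.update v b y))‖ ^ 2 := by positivity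
    rw [← sum_degenerate, ← Complex.norm_of_nonneg hnn, e]
    refine (norm_sum_le _ _).trans (Finset.sum_le_sum fun y _ => ?_)
    refine (norm_sum_le _ _).trans (Finset.sum_le_sum fun y' _ => ?_)
    rw [norm_mul, norm_mul, RCLike.norm_conj]
    refine (mul_le_of_le_one_left (norm_nonneg _) ?_).trans (h3 y y')
    exact mul_le_one₀ (hf _ _) (norm_nonneg _) (hf _ _)
  calc _ = ((q ^ r : ℝ) * ‖∑ v, (∏ i, f i (v i)) * ψ (Φ v)‖) ^ 2 := by rw [mul_pow]
    _ ≤ _ := pow_le_pow_left₀ (by positivity) h1 2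
    _ ≤ _ := h2
    _ ≤ _ := by gcongr

end FormSums

/-! ### Fourier analysis on `ZMod q` and joint equidistribution of the forms. -/

section Counting

variable {q : ℕ} [Fact q.Prime]

/-- The Fourier coefficient of `h` at `s`. -/
noncomputable def fourierCoeffZMod (h : ZMod q → ℝ) (s : ZMod q) : ℂ :=
  (q : ℂ)⁻¹ * ∑ t, (h t : ℂ) * ZMod.stdAddChar (-(s * t))

theorem ofReal_eq_sum_fourierCoeffZMod (h : ZMod q → ℝ) (x : ZMod q) :
    (h x : ℂ) = ∑ s, fourierCoeffZMod h s * ZMod.stdAddChar (s * x) := by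
  have hq : (q : ℂ) ≠ 0 := by exact_mod_cast (Fact.out : q.Prime).ne_zero
  have e : ∀ t, ∑ s, (h t : ℂ) * ZMod.stdAddChar (-(s * t)) * ZMod.stdAddChar (s * x) =
      if t = x then (q : ℂ) * h t else 0 := by
    intro t
    have : ∀ s : ZMod q, (h t : ℂ) * ZMod.stdAddChar (-(s * t)) * ZMod.stdAddChar (s * x) =
        (h t : ℂ) * ZMod.stdAddChar (s * (x - t)) := by
      intro s
      rw [mul_assoc, ← AddChar.map_add_eq_mul]
      congr 2
      ring
    simp only [this]
    rw [← Finset.mul_sum, AddChar.sum_mulShift _ (ZMod.isPrimitive_stdAddChar q)]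
    simp only [sub_eq_zero, ZMod.card, eq_comm (a := x)]
    split_ifs <;> simp [mul_comm]
  simp only [fourierCoeffZMod, mul_assoc, Finset.sum_mul, ← Finset.mul_sum]
  rw [Finset.sum_comm]
  simp only [← mul_assoc, e, Finset.sum_ite_eq', Finset.mem_univ, if_true]
  field_simp

theorem fourierCoeffZMod_zero (h : ZMod q → ℝ) :
    fourierCoeffZMod h 0 = (((∑ t, h t) / q : ℝ) : ℂ) := by
  simp [fourierCoeffZMod, div_eq_inv_mul]

theorem norm_fourierCoeffZMod_le (h : ZMod q → ℝ) (hh : ∀ t, h t ∈ Set.Icc (0 : ℝ) 1) (s : ZMod q) :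
    ‖fourierCoeffZMod h s‖ ≤ 1 := by
  have hq : (0 : ℝ) < q := by exact_mod_cast (Fact.out : q.Prime).pos
  rw [fourierCoeffZMod, norm_mul, norm_inv, Complex.norm_natCast, inv_mul_le_iff₀ hq, mul_one]
  refine (norm_sum_le _ _).trans ?_
  refine (Finset.sum_le_sum (g := fun _ => (1 : ℝ)) fun t _ => ?_).trans ?_
  · rw [norm_mul, AddChar.norm_apply, mul_one, Complex.norm_of_nonneg (hh t).1]
    exact (hh t).2
  · simp [ZMod.card]

theorem fourierCoeffZMod_const_one {h : ZMod q → ℝ} (hh : ∀ t, h t = 1) {s : ZMod q} (hs : s ≠ 0) :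
    fourierCoeffZMod h s = 0 := by
  have e : ∀ t : ZMod q, -(s * t) = t * (0 - s) := fun t => by ring
  simp only [fourierCoeffZMod, hh, Complex.ofReal_one, one_mul, e]
  rw [AddChar.sum_mulShift _ (ZMod.isPrimitive_stdAddChar q)]
  simp [hs]

/-- Degenerate triples have proportion at most `1 - q ^ (-(k + 2))`, where `k = Fintype.card ι`,
whatever `c` is. Its `r`-th power tends to `0`, uniformly in the coefficients and the weights. -/
theorem exists_norm_sum_form_le (q : ℕ) [Fact q.Prime] (ι : Type*) [Fintype ι] [DecidableEq ι]
    {ε : ℝ} (hε : 0 < ε) :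
    ∃ R, ∀ r ≥ R, ∀ (c : Finset ι → ZMod q) (σ : Finset ι), 2 ≤ σ.card → c σ ≠ 0 →
      ∀ f : ι → (Fin r → ZMod q) → ℂ, (∀ i x, ‖f i x‖ ≤ 1) →
      ‖∑ v : ι → Fin r → ZMod q, (∏ i, f i (v i)) * ZMod.stdAddChar (∑ σ, c σ * multiForm σ v)‖ ≤
        ε * (q ^ r : ℝ) ^ Fintype.card ι := by
  have hq : (0 : ℝ) < q := by exact_mod_cast (Fact.out : q.Prime).pos
  have hq1 : (1 : ℝ) ≤ q := by exact_mod_cast (Fact.out : q.Prime).one_lt.le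
  set k := Fintype.card ι with hk
  set θ : ℝ := 1 - ((q : ℝ) ^ (k + 2))⁻¹ with hθ
  have hpos : 0 < ((q : ℝ) ^ (k + 2))⁻¹ := by positivity
  have hθ0 : 0 ≤ θ := by
    have : ((q : ℝ) ^ (k + 2))⁻¹ ≤ 1 := inv_le_one_of_one_le₀ (one_le_pow₀ hq1)
    linarith
  have hθ1 : θ < 1 := by linarith
  obtain ⟨R, hR⟩ := exists_pow_lt_of_lt_one (pow_pos hε 2) hθ1
  refine ⟨R, fun r hr c σ hσ hc f hf => ?_⟩
  obtain ⟨a, ha, b, hb, hab⟩ := Finset.one_lt_card.1 hσ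
  have h1 := sq_norm_sum_form_le (ZMod.isPrimitive_stdAddChar q) c hab f hf
  have h2 : ((degenerateTriples c a b).card : ℝ) ≤ (q : ℝ) ^ (k + 2) * θ := by
    have h := card_degenerateTriples_lt c ha hb hc
    have h' : ((degenerateTriples c a b).card : ℝ) + 1 ≤ (q : ℝ) ^ (k + 2) := by exact_mod_cast h
    have : (q : ℝ) ^ (k + 2) * θ = (q : ℝ) ^ (k + 2) - 1 := by
      rw [hθ, mul_sub, mul_inv_cancel₀ (by positivity), mul_one]
    linarith
  have h3 : ((degenerateTriples c a b).card : ℝ) ^ r ≤ (q ^ r : ℝ) ^ (k + 2) * ε ^ 2 := by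
    calc _ ≤ ((q : ℝ) ^ (k + 2) * θ) ^ r := pow_le_pow_left₀ (by positivity) h2 r
      _ = (q ^ r : ℝ) ^ (k + 2) * θ ^ r := by rw [mul_pow, ← pow_mul, ← pow_mul, mul_comm r]
      _ ≤ _ := by
        gcongr
        exact (pow_le_pow_of_le_one hθ0 hθ1.le hr).trans hR.le
  refine (pow_le_pow_iff_left₀ (norm_nonneg _) (by positivity) two_ne_zero).1 ?_
  have hV : 0 < ((q : ℝ) ^ r) ^ 2 := by positivity
  refine le_of_mul_le_mul_left (h1.trans ?_) hV
  calc _ ≤ (q ^ r : ℝ) ^ k * ((q ^ r : ℝ) ^ (k + 2) * ε ^ 2) := by gcongr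
    _ = _ := by ring

/-- In large dimension, the multilinear forms `multiForm σ`, `2 ≤ #σ`, are jointly almost uniformly
distributed on every product of weights. -/
theorem exists_abs_sum_form_sub_le (q : ℕ) [Fact q.Prime] (ι : Type*) [Fintype ι] [DecidableEq ι]
    {ε : ℝ} (hε : 0 < ε) :
    ∃ R, ∀ r ≥ R, ∀ h : Finset ι → ZMod q → ℝ, (∀ σ t, h σ t ∈ Set.Icc (0 : ℝ) 1) →
      (∀ σ, σ.card ≤ 1 → ∀ t, h σ t = 1) →
      ∀ f : ι → (Fin r → ZMod q) → ℝ, (∀ i x, f i x ∈ Set.Icc (0 : ℝ) 1) →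
      |∑ v : ι → Fin r → ZMod q, (∏ i, f i (v i)) * ∏ σ, h σ (multiForm σ v) -
        (∏ σ, (∑ t, h σ t) / q) * ∑ v : ι → Fin r → ZMod q, ∏ i, f i (v i)| ≤
        ε * (q ^ r : ℝ) ^ Fintype.card ι := by
  -- The number of frequencies, which does not depend on `r`; each nonzero frequency may contribute
  -- an error `ε / N`.
  set N : ℝ := (Fintype.card (Finset ι → ZMod q) : ℝ) with hN
  have hN0 : 0 < N := by
    rw [hN]
    exact_mod_cast Fintype.card_pos
  obtain ⟨R, hR⟩ := exists_norm_sum_form_le q ι (div_pos hε hN0)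
  refine ⟨R, fun r hr h hh h1 f hf => ?_⟩
  set S : (Finset ι → ZMod q) → ℂ := fun c => ∑ v : ι → Fin r → ZMod q,
    (∏ i, (f i (v i) : ℂ)) * ZMod.stdAddChar (∑ σ, c σ * multiForm σ v) with hS
  set A : (Finset ι → ZMod q) → ℂ := fun c => ∏ σ, fourierCoeffZMod (h σ) (c σ) with hA
  have e1 : ((∑ v : ι → Fin r → ZMod q, (∏ i, f i (v i)) * ∏ σ, h σ (multiForm σ v) : ℝ) : ℂ) =
      ∑ c, A c * S c := by
    have : ∀ v : ι → Fin r → ZMod q, ((∏ σ, h σ (multiForm σ v) : ℝ) : ℂ) =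
        ∑ c : Finset ι → ZMod q, A c * ZMod.stdAddChar (∑ σ, c σ * multiForm σ v) := by
      intro v
      rw [Complex.ofReal_prod]
      simp only [ofReal_eq_sum_fourierCoeffZMod]
      rw [Finset.prod_univ_sum, Fintype.piFinset_univ]
      refine Finset.sum_congr rfl fun c _ => ?_
      rw [addChar_sum, hA, Finset.prod_mul_distrib]
    rw [Complex.ofReal_sum]
    simp only [Complex.ofReal_mul, this, hS, Finset.mul_sum]
    rw [Finset.sum_comm]
    refine Finset.sum_congr rfl fun c _ => Finset.sum_congr rfl fun v _ => ?_
    rw [Complex.ofReal_prod]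
    ring
  have e2 : (((∏ σ, (∑ t, h σ t) / q) * ∑ v : ι → Fin r → ZMod q, ∏ i, f i (v i) : ℝ) : ℂ) =
      A 0 * S 0 := by
    simp [hA, hS, fourierCoeffZMod_zero]
  rw [← Real.norm_eq_abs, ← Complex.norm_real, Complex.ofReal_sub, e1, e2,
    ← Finset.add_sum_erase _ _ (Finset.mem_univ 0), add_sub_cancel_left]
  -- A nonzero frequency supported at some `σ` with at most one element has zero Fourier
  -- coefficient, since `h σ = 1` there; otherwise it involves a form in at least two variables and
  -- the exponential sum is small.
  have hc : ∀ c ∈ Finset.univ.erase (0 : Finset ι → ZMod q),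
      ‖A c * S c‖ ≤ ε / N * (q ^ r : ℝ) ^ Fintype.card ι := by
    intro c hc
    obtain ⟨σ, hσ⟩ := Function.ne_iff.1 (Finset.ne_of_mem_erase hc)
    by_cases hcard : σ.card ≤ 1
    · have : A c = 0 := Finset.prod_eq_zero (Finset.mem_univ σ)
        (fourierCoeffZMod_const_one (h1 σ hcard) hσ)
      rw [this, zero_mul, norm_zero]
      positivity
    · rw [norm_mul]
      refine (mul_le_of_le_one_left (norm_nonneg _) ?_).trans
        (hR r hr c σ (by omega) hσ (fun i x => (f i x : ℂ)) ?_)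
      · rw [hA, norm_prod]
        exact Finset.prod_le_one (fun _ _ => norm_nonneg _)
          fun τ _ => norm_fourierCoeffZMod_le _ (hh τ) _
      · intro i x
        rw [Complex.norm_of_nonneg (hf i x).1]
        exact (hf i x).2
  refine (norm_sum_le_of_le _ hc).trans ?_
  rw [Finset.sum_const, nsmul_eq_mul]
  have hle : ((Finset.univ.erase (0 : Finset ι → ZMod q)).card : ℝ) ≤ N := by
    rw [hN]
    exact_mod_cast Finset.card_le_univ _
  calc _ ≤ N * (ε / N * (q ^ r : ℝ) ^ Fintype.card ι) := by gcongr
    _ = _ := by field_simp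

end Counting

/-! ### Elementary estimates for products, densities and repeated entries. -/

theorem abs_prod_sub_prod_le {ι : Type*} (s : Finset ι) (f g : ι → ℝ)
    (hf : ∀ i ∈ s, f i ∈ Set.Icc (0 : ℝ) 1) (hg : ∀ i ∈ s, g i ∈ Set.Icc (0 : ℝ) 1) :
    |∏ i ∈ s, f i - ∏ i ∈ s, g i| ≤ ∑ i ∈ s, |f i - g i| := by
  classical
  induction s using Finset.induction_on with
  | empty => simp
  | insert a s ha ih =>
    rw [Finset.prod_insert ha, Finset.prod_insert ha, Finset.sum_insert ha]
    have ih' := ih (fun i hi => hf i (Finset.mem_insert_of_mem hi))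
      (fun i hi => hg i (Finset.mem_insert_of_mem hi))
    have hF : |∏ i ∈ s, f i| ≤ 1 := by
      rw [Finset.abs_prod]
      refine Finset.prod_le_one (fun _ _ => abs_nonneg _) fun i hi => ?_
      have := hf i (Finset.mem_insert_of_mem hi)
      exact abs_le.2 ⟨by linarith [this.1], this.2⟩
    have hG : |g a| ≤ 1 := by
      have := hg a (Finset.mem_insert_self _ _)
      exact abs_le.2 ⟨by linarith [this.1], this.2⟩
    have e : f a * ∏ i ∈ s, f i - g a * ∏ i ∈ s, g i =
        (f a - g a) * ∏ i ∈ s, f i + g a * (∏ i ∈ s, f i - ∏ i ∈ s, g i) := by ring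
    rw [e]
    refine (abs_add_le _ _).trans (add_le_add ?_ ?_)
    · rw [abs_mul]
      exact mul_le_of_le_one_right (abs_nonneg _) hF
    · rw [abs_mul]
      exact (mul_le_of_le_one_left (abs_nonneg _) hG).trans ih'

/-- The count is `⌈q * p⌉₊`, so rounding costs less than one residue. -/
theorem abs_card_val_lt_div_sub_le {q : ℕ} [Fact q.Prime] {p : ℝ} (hp : p ∈ Set.Icc (0 : ℝ) 1) :
    |(∑ t : ZMod q, if (t.val : ℝ) < q * p then (1 : ℝ) else 0) / q - p| ≤ 1 / q := by
  have hq : (0 : ℝ) < q := by exact_mod_cast (Fact.out : q.Prime).pos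
  have hceil : ⌈q * p⌉₊ ≤ q := Nat.ceil_le.2 (mul_le_of_le_one_right hq.le hp.2)
  have hcard : (∑ t : ZMod q, if (t.val : ℝ) < q * p then (1 : ℝ) else 0) = ⌈q * p⌉₊ := by
    rw [Finset.sum_boole]
    congr 1
    rw [← Finset.card_range ⌈q * p⌉₊]
    refine Finset.card_nbij' (fun t => t.val) (fun n => (n : ZMod q)) ?_ ?_ ?_ ?_
    · intro t ht
      simpa [Nat.lt_ceil] using ht
    · intro n hn
      have hn' : n < ⌈q * p⌉₊ := by simpa using hn
      simp only [Finset.coe_filter, Finset.mem_univ, true_and, Set.mem_ofPred_eq]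
      rw [ZMod.val_cast_of_lt (hn'.trans_le hceil)]
      exact Nat.lt_ceil.1 hn'
    · intro t _
      exact ZMod.natCast_zmod_val t
    · intro n hn
      have hn' : n < ⌈q * p⌉₊ := by simpa using hn
      exact ZMod.val_cast_of_lt (hn'.trans_le hceil)
  rw [hcard]
  have h1 := Nat.le_ceil (q * p)
  have h2 := Nat.ceil_lt_add_one (mul_nonneg hq.le hp.1)
  have e : (⌈q * p⌉₊ : ℝ) / q - p = (⌈q * p⌉₊ - q * p) / q := by field_simp
  rw [e, abs_of_nonneg (div_nonneg (by linarith) hq.le)]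
  exact div_le_div_of_nonneg_right (by linarith) hq.le

/-- Union bound over the ordered pairs of distinct indices, of which there are at most `k ^ 2`. -/
theorem card_mul_card_not_injective_le {k : ℕ} {V : Type*} [Fintype V] [DecidableEq V] :
    Fintype.card V * (Finset.univ.filter fun v : Fin k → V => ¬ Function.Injective v).card ≤
      k ^ 2 * Fintype.card V ^ k := by
  have hpair : ∀ i i' : Fin k, i ≠ i' → Fintype.card V *
      (Finset.univ.filter fun v : Fin k → V => v i = v i').card = Fintype.card V ^ k := by
    intro i i' hi
    have h := sum_sum_update i (fun v : Fin k → V => if v i = v i' then 1 else 0)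
    simp only [Function.update_self, Function.update_of_ne hi.symm, Finset.sum_ite_eq',
      Finset.mem_univ, if_true, Finset.sum_const, smul_eq_mul, mul_one, Finset.sum_boole,
      Finset.card_univ, Fintype.card_fun, Fintype.card_fin, Nat.cast_id] at h
    exact h.symm
  have hsub : (Finset.univ.filter fun v : Fin k → V => ¬ Function.Injective v) ⊆
      (Finset.univ.filter fun p : Fin k × Fin k => p.1 ≠ p.2).biUnion
        fun p => Finset.univ.filter fun v : Fin k → V => v p.1 = v p.2 := by
    intro v hv
    simp only [Function.Injective, Finset.mem_filter, Finset.mem_univ, true_and, not_forall] at hv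
    obtain ⟨i, i', h, hne⟩ := hv
    simp only [Finset.mem_biUnion, Finset.mem_filter, Finset.mem_univ, true_and]
    exact ⟨(i, i'), hne, h⟩
  calc _ ≤ Fintype.card V * ∑ p ∈ Finset.univ.filter fun p : Fin k × Fin k => p.1 ≠ p.2,
        (Finset.univ.filter fun v : Fin k → V => v p.1 = v p.2).card :=
        Nat.mul_le_mul_left _ ((Finset.card_le_card hsub).trans Finset.card_biUnion_le)
    _ = ∑ p ∈ Finset.univ.filter fun p : Fin k × Fin k => p.1 ≠ p.2, Fintype.card V ^ k := by
        rw [Finset.mul_sum]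
        exact Finset.sum_congr rfl fun p hp => hpair _ _ (Finset.mem_filter.1 hp).2
    _ ≤ _ := by
        rw [Finset.sum_const, smul_eq_mul]
        refine Nat.mul_le_mul_right _ ((Finset.card_le_univ _).trans ?_)
        simp [pow_two]

/-! ### The complex defined by the forms and its simplex densities. -/

namespace Complexon

theorem onFace_mem_Icc (W : Complexon) {k : ℕ} (x : Fin k → unitInterval) (σ : Finset (Fin k)) :
    W.onFace x σ ∈ Set.Icc (0 : ℝ) 1 :=
  W.mem_Icc' _ _

theorem onFace_map (W : Complexon) {k n : ℕ} (x : Fin n → unitInterval) (j : Fin k ↪ Fin n)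
    (σ : Finset (Fin k)) : W.onFace x (σ.map j) = W.onFace (x ∘ j) σ := by
  symm
  let e : σ ≃ σ.map j := Equiv.ofBijective (fun i => ⟨j i, Finset.mem_map_of_mem j i.2⟩) <| by
    refine ⟨fun a b h => Subtype.ext (j.injective (congrArg Subtype.val h)), fun b => ?_⟩
    obtain ⟨i, hi, h⟩ := Finset.mem_map.1 b.2
    exact ⟨⟨i, hi⟩, Subtype.ext h⟩
  refine W.toFun_congr
    (((σ.orderIsoOfFin rfl).toEquiv.trans e).trans
      ((σ.map j).orderIsoOfFin rfl).symm.toEquiv) _ _ ?_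
  intro i
  simp [e, ← Finset.coe_orderIsoOfFin_apply]
  rfl

/-- The complex whose simplices are the sets all of whose subsets with at least two
elements satisfy `P`. -/
def hereditaryComplex {n : ℕ} (P : Finset (Fin n) → Prop) : AbstractSimplicialComplex (Fin n) where
  faces := {τ | τ.Nonempty ∧ ∀ ρ ⊆ τ, 2 ≤ ρ.card → P ρ}
  isRelLowerSet_faces := fun {_} h => ⟨h.1, fun _ hρτ hρ => ⟨hρ, fun _ hρ' => h.2 _ (hρ'.trans hρτ)⟩⟩
  singleton_mem := by
    intro v
    refine ⟨Finset.singleton_nonempty v, fun ρ hρ hc => ?_⟩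
    have := Finset.card_le_card hρ
    simp at this
    omega

theorem image_mem_hereditaryComplex {n k : ℕ} (hk : 1 ≤ k) (P : Finset (Fin n) → Prop)
    (j : Fin k ↪ Fin n) : Finset.univ.image j ∈ (hereditaryComplex P).faces ↔
      ∀ σ : Finset (Fin k), 2 ≤ σ.card → P (σ.map j) := by
  have hne : (Finset.univ.image j).Nonempty := by
    rw [Finset.image_nonempty]
    exact ⟨⟨0, hk⟩, Finset.mem_univ _⟩
  have e : Finset.univ.image j = Finset.univ.map j := by
    ext; simp
  constructor
  · intro h σ hσ
    refine h.2 _ ?_ (by simpa using hσ)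
    rw [e]
    exact Finset.map_subset_map.2 (Finset.subset_univ σ)
  · intro h
    refine ⟨hne, fun ρ hρ hc => ?_⟩
    rw [e, Finset.subset_map_iff] at hρ
    obtain ⟨σ, -, rfl⟩ := hρ
    exact h σ (by simpa using hc)

end Complexon

namespace Complexon

/-- The complex on the vertex set `Fin n ≃ Fin m × (ZMod q)^r` in which the face `ρ` is filled in
when the value of the multilinear form at its vertices lies below `q` times the value of `W` at the
points attached to the vertices. -/
noncomputable def formComplex (W : Complexon) {m n q r : ℕ} [Fact q.Prime] (pt : Fin m → unitInterval)
    (e : Fin m × (Fin r → ZMod q) ≃ Fin n) : AbstractSimplicialComplex (Fin n) :=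
  hereditaryComplex fun ρ =>
    ((∑ j, ∏ u ∈ ρ, (e.symm u).2 j : ZMod q).val : ℝ) < q * W.onFace (fun u => pt (e.symm u).1) ρ

open Classical in
/-- The indicator of the injective tuples whose entries span a simplex of `K`. -/
noncomputable def simplexIndicator {n k : ℕ} (K : AbstractSimplicialComplex (Fin n))
    (j : Fin k → Fin n) : ℝ :=
  if Function.Injective j ∧ Finset.univ.image j ∈ K.faces then 1 else 0

theorem simplexIndicator_mem_Icc {n k : ℕ} (K : AbstractSimplicialComplex (Fin n))
    (j : Fin k → Fin n) : simplexIndicator K j ∈ Set.Icc (0 : ℝ) 1 := by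
  rw [simplexIndicator]
  split_ifs <;> simp

open Classical in
/-- The indicator that the face with value `t` of the multilinear form and density `p` is filled in. -/
noncomputable def faceIndicator {q k : ℕ} (p : ℝ) (σ : Finset (Fin k)) (t : ZMod q) : ℝ :=
  if σ.card ≤ 1 ∨ (t.val : ℝ) < q * p then 1 else 0

theorem faceIndicator_mem_Icc {q k : ℕ} (p : ℝ) (σ : Finset (Fin k)) (t : ZMod q) :
    faceIndicator p σ t ∈ Set.Icc (0 : ℝ) 1 := by
  rw [faceIndicator]
  split_ifs <;> simp

/-- Since membership is decided subset by subset, the indicator is a product over faces, the same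
shape as `∂W`. Injectivity of `v` makes the vertices distinct even when they lie in one block. -/
theorem simplexIndicator_formComplex (W : Complexon) {m n q r k : ℕ} [Fact q.Prime] (hk : 1 ≤ k)
    (pt : Fin m → unitInterval) (e : Fin m × (Fin r → ZMod q) ≃ Fin n) (a : Fin k → Fin m)
    (v : Fin k → Fin r → ZMod q) (hv : Function.Injective v) :
    simplexIndicator (W.formComplex pt e) (fun i => e (a i, v i)) =
      ∏ σ, faceIndicator (W.onFace (fun i => pt (a i)) σ) σ (multiForm σ v) := by
  classical
  have hj : Function.Injective fun i => e (a i, v i) := fun i i' h =>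
    hv (Prod.ext_iff.1 (e.injective h)).2
  have h := image_mem_hereditaryComplex hk (fun ρ : Finset (Fin n) =>
    ((∑ j, ∏ u ∈ ρ, (e.symm u).2 j : ZMod q).val : ℝ) < q * W.onFace (fun u => pt (e.symm u).1) ρ)
    ⟨_, hj⟩
  simp only [onFace_map, Finset.prod_map, Function.Embedding.coeFn_mk, Function.comp_def,
    Equiv.symm_apply_apply] at h
  simp only [simplexIndicator, faceIndicator, formComplex, hj, true_and, h]
  rw [Finset.prod_ite_zero]
  simp only [Finset.prod_const_one, Finset.mem_univ, true_implies]
  refine if_congr ?_ rfl rfl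
  refine forall_congr' fun σ => ?_
  rw [or_iff_not_imp_left, not_le]
  rfl

theorem abs_avg_faceIndicator_sub_le (W : Complexon) {q k : ℕ} [Fact q.Prime]
    (x : Fin k → unitInterval) (σ : Finset (Fin k)) :
    |(∑ t : ZMod q, faceIndicator (W.onFace x σ) σ t) / q - W.onFace x σ| ≤ 1 / q := by
  by_cases hσ : σ.card ≤ 1
  · have hq : (q : ℝ) ≠ 0 := by exact_mod_cast (Fact.out : q.Prime).ne_zero
    have h1 : W.onFace x σ = 1 := W.eq_one' _ hσ _
    simp [faceIndicator, hσ, h1, ZMod.card, hq]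
  · have := abs_card_val_lt_div_sub_le (q := q) (W.onFace_mem_Icc x σ)
    simpa only [faceIndicator, hσ, false_or] using this

theorem avg_faceIndicator_mem_Icc {q k : ℕ} [Fact q.Prime] (p : ℝ) (σ : Finset (Fin k)) :
    (∑ t : ZMod q, faceIndicator p σ t) / q ∈ Set.Icc (0 : ℝ) 1 := by
  have hq : (0 : ℝ) < q := by exact_mod_cast (Fact.out : q.Prime).pos
  refine ⟨div_nonneg (Finset.sum_nonneg fun t _ => (faceIndicator_mem_Icc p σ t).1) hq.le, ?_⟩
  rw [div_le_one hq]
  refine (Finset.sum_le_sum fun t _ => (faceIndicator_mem_Icc p σ t).2).trans ?_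
  simp [ZMod.card]

/-- The counting property of the dimension `r` for `k`-tuples of vectors, with error `δ`. -/
def FormsEquidistributed (q r k : ℕ) [Fact q.Prime] (δ : ℝ) : Prop :=
  ∀ h : Finset (Fin k) → ZMod q → ℝ, (∀ σ t, h σ t ∈ Set.Icc (0 : ℝ) 1) →
    (∀ σ, σ.card ≤ 1 → ∀ t, h σ t = 1) →
    ∀ f : Fin k → (Fin r → ZMod q) → ℝ, (∀ i x, f i x ∈ Set.Icc (0 : ℝ) 1) →
      |∑ v : Fin k → Fin r → ZMod q, (∏ i, f i (v i)) * ∏ σ, h σ (multiForm σ v) -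
        (∏ σ, (∑ t, h σ t) / q) * ∑ v : Fin k → Fin r → ZMod q, ∏ i, f i (v i)| ≤ δ * (q ^ r : ℝ) ^ k

/-- Three errors add up: rounding the `2 ^ k` face densities to multiples of `1 / q`, the failure of
exact equidistribution, and the tuples with repeated vectors. -/
theorem abs_sum_part_sub_simplexIndicator_le (W : Complexon) {m n q r k : ℕ} [Fact q.Prime]
    (hk : 1 ≤ k) (pt : Fin m → unitInterval) (e : Fin m × (Fin r → ZMod q) ≃ Fin n) {δ : ℝ}
    (hq : 1 / (q : ℝ) ≤ δ) (hr : (k : ℝ) ^ 2 / q ^ r ≤ δ) (hδ : FormsEquidistributed q r k δ)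
    (f : Fin k → (Fin r → ZMod q) → ℝ) (hf : ∀ i x, f i x ∈ Set.Icc (0 : ℝ) 1) (a : Fin k → Fin m) :
    |∑ v : Fin k → Fin r → ZMod q, (W.faceted.toFun k (fun i => pt (a i)) -
      simplexIndicator (W.formComplex pt e) (fun i => e (a i, v i))) * ∏ i, f i (v i)| ≤
      (2 ^ k + 2) * δ * (q ^ r : ℝ) ^ k := by
  classical
  have hq0 : (0 : ℝ) < q := by exact_mod_cast (Fact.out : q.Prime).pos
  have hV : Fintype.card (Fin r → ZMod q) = q ^ r := by simp [ZMod.card]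
  have hF : ∀ v : Fin k → Fin r → ZMod q, (∏ i, f i (v i)) ∈ Set.Icc (0 : ℝ) 1 := fun v =>
    ⟨Finset.prod_nonneg fun i _ => (hf i _).1,
      Finset.prod_le_one (fun i _ => (hf i _).1) fun i _ => (hf i _).2⟩
  set h : Finset (Fin k) → ZMod q → ℝ :=
    fun σ => faceIndicator (W.onFace (fun i => pt (a i)) σ) σ with hh
  set p : ℝ := W.faceted.toFun k (fun i => pt (a i)) with hp
  set A : ℝ := ∏ σ, (∑ t, h σ t) / q with hA
  set G : (Fin k → Fin r → ZMod q) → ℝ :=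
    fun v => simplexIndicator (W.formComplex pt e) (fun i => e (a i, v i)) with hG
  set H : (Fin k → Fin r → ZMod q) → ℝ := fun v => ∏ σ, h σ (multiForm σ v) with hH
  have hHmem : ∀ v, H v ∈ Set.Icc (0 : ℝ) 1 := fun v =>
    ⟨Finset.prod_nonneg fun σ _ => (faceIndicator_mem_Icc _ _ _).1,
      Finset.prod_le_one (fun σ _ => (faceIndicator_mem_Icc _ _ _).1)
        fun σ _ => (faceIndicator_mem_Icc _ _ _).2⟩
  have hsumF : |∑ v : Fin k → Fin r → ZMod q, ∏ i, f i (v i)| ≤ (q ^ r : ℝ) ^ k := by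
    rw [abs_of_nonneg (Finset.sum_nonneg fun v _ => (hF v).1)]
    refine (Finset.sum_le_sum fun v _ => (hF v).2).trans ?_
    simp [ZMod.card]
  have h1 : |p - A| ≤ 2 ^ k * δ := by
    have := abs_prod_sub_prod_le Finset.univ (fun σ => W.onFace (fun i => pt (a i)) σ)
      (fun σ => (∑ t, h σ t) / q) (fun σ _ => W.onFace_mem_Icc _ σ)
      (fun σ _ => avg_faceIndicator_mem_Icc _ σ)
    refine this.trans ((Finset.sum_le_sum (g := fun _ => δ) fun σ _ => ?_).trans ?_)
    · rw [abs_sub_comm]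
      exact (abs_avg_faceIndicator_sub_le W _ σ).trans hq
    · simp
  have h2 : |∑ v, (∏ i, f i (v i)) * H v -
      A * ∑ v : Fin k → Fin r → ZMod q, ∏ i, f i (v i)| ≤ δ * (q ^ r : ℝ) ^ k :=
    hδ h (fun σ t => faceIndicator_mem_Icc _ _ _) (fun σ hσ t => by simp [hh, faceIndicator, hσ]) f hf
  -- `H` and `G` differ only at non-injective tuples, a proportion of at most `k ^ 2 / q ^ r`.
  have h3 : |∑ v, (H v - G v) * ∏ i, f i (v i)| ≤ δ * (q ^ r : ℝ) ^ k := by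
    have hbound : ∀ v : Fin k → Fin r → ZMod q, |(H v - G v) * ∏ i, f i (v i)| ≤
        if ¬ Function.Injective v then 1 else 0 := by
      intro v
      by_cases hv : Function.Injective v
      · have : G v = H v := simplexIndicator_formComplex W hk pt e a v hv
        simp [this, hv]
      · rw [if_pos hv, abs_mul, abs_of_nonneg (hF v).1]
        refine mul_le_one₀ ?_ (hF v).1 (hF v).2
        have g := simplexIndicator_mem_Icc (W.formComplex pt e) (fun i => e (a i, v i))
        exact abs_le.2 ⟨by linarith [(hHmem v).1, g.2], by linarith [(hHmem v).2, g.1]⟩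
    refine (Finset.abs_sum_le_sum_abs _ _).trans ((Finset.sum_le_sum fun v _ => hbound v).trans ?_)
    rw [Finset.sum_boole]
    have hc := card_mul_card_not_injective_le (k := k) (V := Fin r → ZMod q)
    rw [hV] at hc
    have hc' : (q ^ r : ℝ) * ((Finset.univ.filter fun v : Fin k → Fin r → ZMod q =>
        ¬ Function.Injective v).card : ℝ) ≤ k ^ 2 * (q ^ r : ℝ) ^ k := by exact_mod_cast hc
    have hqr : (0 : ℝ) < q ^ r := by positivity
    refine le_trans ?_ (mul_le_mul_of_nonneg_right hr (by positivity))
    rw [div_mul_eq_mul_div, le_div_iff₀ hqr, mul_comm]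
    exact hc'
  have e1 : ∑ v, (p - G v) * ∏ i, f i (v i) = 
      (p - A) * ∑ v : Fin k → Fin r → ZMod q, ∏ i, f i (v i) -
      (∑ v, (∏ i, f i (v i)) * H v - A * ∑ v : Fin k → Fin r → ZMod q, ∏ i, f i (v i)) +
      ∑ v, (H v - G v) * ∏ i, f i (v i) := by
    simp only [sub_mul, Finset.sum_sub_distrib, ← Finset.mul_sum]
    simp only [mul_comm]
    ring
  rw [e1]
  have h4 : |(p - A) * ∑ v : Fin k → Fin r → ZMod q, ∏ i, f i (v i)| ≤
      2 ^ k * δ * (q ^ r : ℝ) ^ k := by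
    rw [abs_mul]
    exact mul_le_mul h1 hsumF (abs_nonneg _) ((abs_nonneg _).trans h1)
  refine (abs_add_le _ _).trans ((add_le_add ((abs_sub _ _).trans (add_le_add h4 h2)) h3).trans ?_)
  exact le_of_eq (by ring)

theorem abs_sum_sub_simplexIndicator_le (W : Complexon) {m n q r k : ℕ} [Fact q.Prime]
    (hk : 1 ≤ k) (pt : Fin m → unitInterval) (e : Fin m × (Fin r → ZMod q) ≃ Fin n) {δ : ℝ}
    (hq : 1 / (q : ℝ) ≤ δ) (hr : (k : ℝ) ^ 2 / q ^ r ≤ δ) (hδ : FormsEquidistributed q r k δ)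
    (f : Fin k → Fin n → ℝ) (hf : ∀ i u, f i u ∈ Set.Icc (0 : ℝ) 1) :
    |∑ j : Fin k → Fin n, (W.faceted.toFun k (fun i => pt (e.symm (j i)).1) -
      simplexIndicator (W.formComplex pt e) j) * ∏ i, f i (j i)| ≤ (2 ^ k + 2) * δ * (n : ℝ) ^ k := by
  have hn : (n : ℝ) = m * q ^ r := by
    have := Fintype.card_congr e
    simp only [Fintype.card_prod, Fintype.card_fin, Fintype.card_fun, ZMod.card] at this
    exact_mod_cast this.symm
  have hsum : ∑ j : Fin k → Fin n, (W.faceted.toFun k (fun i => pt (e.symm (j i)).1) -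
      simplexIndicator (W.formComplex pt e) j) * ∏ i, f i (j i) =
      ∑ a : Fin k → Fin m, ∑ v : Fin k → Fin r → ZMod q,
        (W.faceted.toFun k (fun i => pt (a i)) -
          simplexIndicator (W.formComplex pt e) (fun i => e (a i, v i))) *
          ∏ i, f i (e (a i, v i)) := by
    rw [← Fintype.sum_prod_type']
    refine (Fintype.sum_equiv (((Equiv.arrowProdEquivProdArrow (Fin k) (fun _ => Fin m)
      (fun _ => Fin r → ZMod q)).symm).trans (Equiv.arrowCongr (Equiv.refl _) e)) _ _ ?_).symm
    intro p
    simp [Equiv.arrowProdEquivProdArrow, Equiv.arrowCongr, Function.comp_def]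
  rw [hsum]
  refine (Finset.abs_sum_le_sum_abs _ _).trans ?_
  have hle : ∀ a : Fin k → Fin m, |∑ v : Fin k → Fin r → ZMod q,
        (W.faceted.toFun k (fun i => pt (a i)) -
          simplexIndicator (W.formComplex pt e) (fun i => e (a i, v i))) *
          ∏ i, f i (e (a i, v i))| ≤ (2 ^ k + 2) * δ * (q ^ r : ℝ) ^ k :=
    fun a => abs_sum_part_sub_simplexIndicator_le W hk pt e hq hr hδ
      (fun i x => f i (e (a i, x))) (fun i x => hf i _) a
  refine (Finset.sum_le_sum fun a _ => hle a).trans (le_of_eq ?_)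
  simp [hn, mul_pow]
  ring

end Complexon

/-! ### From sums over vertices to integrals over boxes. -/

namespace Complexon

/-- The index of the cell of `x`, with the point `1` put into the last cell. -/
noncomputable def cellIndex (n : ℕ) (hn : 0 < n) (x : unitInterval) : Fin n :=
  ⟨min ⌊(x : ℝ) * n⌋₊ (n - 1), by omega⟩

theorem cellIndex_bounds {n : ℕ} (hn : 0 < n) (x : unitInterval) :
    ((cellIndex n hn x : ℕ) : ℝ) ≤ x * n ∧ (x : ℝ) * n ≤ ((cellIndex n hn x : ℕ) : ℝ) + 1 := by
  have hx0 : 0 ≤ (x : ℝ) * n := mul_nonneg x.2.1 (Nat.cast_nonneg n)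
  have hx1 : (x : ℝ) * n ≤ n := mul_le_of_le_one_left (Nat.cast_nonneg n) x.2.2
  have h1 := Nat.floor_le hx0
  have h2 := Nat.lt_floor_add_one ((x : ℝ) * n)
  refine ⟨le_trans ?_ h1, ?_⟩
  · exact_mod_cast min_le_left _ _
  · rcases le_total ⌊(x : ℝ) * n⌋₊ (n - 1) with h | h
    · simp only [cellIndex, min_eq_left h]
      exact h2.le
    · simp only [cellIndex, min_eq_right h]
      rw [Nat.cast_pred hn]
      linarith

theorem cellIndex_of_mem_cell {n : ℕ} (hn : 0 < n) {x : unitInterval} {j : Fin n}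
    (h : x ∈ cell n j) : cellIndex n hn x = j := by
  have hn' : (0 : ℝ) < n := by exact_mod_cast hn
  have h1 : (j : ℝ) ≤ x * n := (div_le_iff₀ hn').1 h.1
  have h2 : (x : ℝ) * n < j + 1 := (lt_div_iff₀ hn').1 h.2
  have hfl : ⌊(x : ℝ) * n⌋₊ = j := (Nat.floor_eq_iff (le_trans (Nat.cast_nonneg _) h1)).2 ⟨h1, h2⟩
  ext
  simp only [cellIndex, hfl]
  omega

theorem mem_cell_cellIndex {n : ℕ} (hn : 0 < n) {x : unitInterval} (hx : x ≠ 1) :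
    x ∈ cell n (cellIndex n hn x) := by
  have hn' : (0 : ℝ) < n := by exact_mod_cast hn
  refine ⟨(div_le_iff₀ hn').2 (cellIndex_bounds hn x).1, (lt_div_iff₀ hn').2 ?_⟩
  have hx1 : (x : ℝ) < 1 := lt_of_le_of_ne x.2.2 fun h => hx (Subtype.ext h)
  have h2 : (x : ℝ) * n < n := mul_lt_of_lt_one_left hn' hx1
  have h3 : ⌊(x : ℝ) * n⌋₊ < n :=
    (Nat.floor_lt (mul_nonneg x.2.1 (Nat.cast_nonneg n))).2 h2
  have h4 : min ⌊(x : ℝ) * n⌋₊ (n - 1) = ⌊(x : ℝ) * n⌋₊ := by omega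
  simp only [cellIndex, h4]
  exact Nat.lt_floor_add_one _

theorem measurable_cellIndex {n : ℕ} (hn : 0 < n) : Measurable (cellIndex n hn) := by
  have h : Measurable fun x : unitInterval => ⌊(x : ℝ) * n⌋₊ :=
    Nat.measurable_floor.comp (measurable_subtype_coe.mul_const _)
  exact (measurable_of_countable fun t : ℕ => (⟨min t (n - 1), by omega⟩ : Fin n)).comp h

theorem volume_cellIndex_preimage_le {n : ℕ} (hn : 0 < n) (j : Fin n) :
    volume (cellIndex n hn ⁻¹' {j}) ≤ ENNReal.ofReal (1 / n) := by
  have hn' : (0 : ℝ) < n := by exact_mod_cast hn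
  have hj : ((j : ℕ) : ℝ) + 1 ≤ n := by exact_mod_cast j.2
  have h0 : (0 : ℝ) ≤ (j : ℝ) / n := by positivity
  have h1 : ((j : ℝ) + 1) / n ≤ 1 := (div_le_one hn').2 hj
  have h01 : (j : ℝ) / n ≤ ((j : ℝ) + 1) / n := by gcongr; linarith
  have hsub : cellIndex n hn ⁻¹' {j} ⊆ Set.Icc (⟨(j : ℝ) / n, h0, h01.trans h1⟩ : unitInterval)
      ⟨((j : ℝ) + 1) / n, h0.trans h01, h1⟩ := by
    intro x hx
    have hx' : cellIndex n hn x = j := hx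
    have hb := cellIndex_bounds hn x
    rw [hx'] at hb
    exact ⟨(div_le_iff₀ hn').2 hb.1, (le_div_iff₀ hn').2 hb.2⟩
  refine (measure_mono hsub).trans ?_
  rw [unitInterval.volume_Icc]
  refine ENNReal.ofReal_le_ofReal (le_of_eq ?_)
  simp only
  ring

/-- On a box the cell indices of the coordinates are independent: the restricted product measure
pushes forward to a product measure. This turns the sets `S i` into weights on single vertices. -/
theorem setIntegral_comp_cellIndex {n k : ℕ} (hn : 0 < n) (S : Fin k → Set unitInterval)
    (G : (Fin k → Fin n) → ℝ) :
    ∫ x in Set.univ.pi S, G (fun i => cellIndex n hn (x i)) =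
      ∑ j, G j * ∏ i, volume.real (S i ∩ cellIndex n hn ⁻¹' {j i}) := by
  have hm := measurable_cellIndex hn
  have hmap : ((volume : Measure (Fin k → unitInterval)).restrict (Set.univ.pi S)).map
      (fun x i => cellIndex n hn (x i)) =
      Measure.pi fun i => ((volume : Measure unitInterval).restrict (S i)).map (cellIndex n hn) := by
    rw [volume_pi, Measure.restrict_pi_pi]
    exact Measure.pi_map_pi fun i => hm.aemeasurable
  have hmeas : Measurable fun (x : Fin k → unitInterval) i => cellIndex n hn (x i) :=
    measurable_pi_lambda _ fun i => hm.comp (measurable_pi_apply i)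
  rw [← integral_map (f := G) hmeas.aemeasurable (measurable_of_countable G).aestronglyMeasurable,
    hmap, integral_fintype Integrable.of_finite]
  refine Finset.sum_congr rfl fun j _ => ?_
  rw [smul_eq_mul, mul_comm, measureReal_def, Measure.pi_singleton, ENNReal.toReal_prod]
  congr 1
  refine Finset.prod_congr rfl fun i _ => ?_
  rw [Measure.map_apply hm (measurableSet_singleton _),
    Measure.restrict_apply (hm (measurableSet_singleton _)), Set.inter_comm, measureReal_def]

theorem ae_forall_ne_one (k : ℕ) : ∀ᵐ x : Fin k → unitInterval, ∀ i, x i ≠ 1 := by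
  rw [ae_all_iff]
  intro i
  have h : ∀ᵐ t : unitInterval, t ≠ 1 := by
    simp [ae_iff]
  exact (Measure.quasiMeasurePreserving_eval (fun _ : Fin k => (volume : Measure unitInterval)) i).ae h

theorem onFace_univ (W : Complexon) {k : ℕ} (x : Fin k → unitInterval) :
    W.onFace x Finset.univ = W.toFun k x := by
  refine W.toFun_congr (((Finset.univ : Finset (Fin k)).orderIsoOfFin rfl).toEquiv.trans
    (Equiv.subtypeUnivEquiv Finset.mem_univ)) _ _ fun i => ?_
  rfl

/-- The values are `0` and `1`, faces of simplices are simplices, and the full index set is itself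
one of the factors. -/
theorem faceted_ofComplex {n : ℕ} (K : AbstractSimplicialComplex (Fin n)) :
    (ofComplex K).faceted.toFun = (ofComplex K).toFun := by
  classical
  funext k x
  change ∏ σ : Finset (Fin k), (ofComplex K).onFace x σ = _
  by_cases hx : k ≤ 1 ∨ x ∈ simplexTuples K k
  · have h1 : (ofComplex K).toFun k x = 1 := if_pos hx
    rw [h1]
    refine Finset.prod_eq_one fun σ _ => ?_
    refine if_pos ?_
    by_cases hσ : σ.card ≤ 1
    · exact Or.inl hσ
    · have hkσ : σ.card ≤ k := by simpa using Finset.card_le_univ σ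
      obtain ⟨j, hj, hK, hc⟩ := hx.resolve_left (by omega)
      refine Or.inr ⟨fun i => j (σ.orderEmbOfFin rfl i), hj.comp (σ.orderEmbOfFin rfl).injective,
        ?_, fun i => hc _⟩
      refine (K.isRelLowerSet_faces hK).2 ?_ ?_
      · intro u hu
        obtain ⟨i, -, rfl⟩ := Finset.mem_image.1 hu
        exact Finset.mem_image_of_mem _ (Finset.mem_univ _)
      · rw [Finset.image_nonempty]
        exact ⟨⟨0, by omega⟩, Finset.mem_univ _⟩
  · have h0 : (ofComplex K).toFun k x = 0 := if_neg hx
    rw [h0]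
    refine Finset.prod_eq_zero (Finset.mem_univ Finset.univ) ?_
    rw [onFace_univ, h0]

/-- The half-open cells miss the point `1`, which `cellIndex` assigns to the last cell; hence the
hypothesis `hx`, which holds almost everywhere. -/
theorem ofComplex_eq_simplexIndicator {n k : ℕ} (hn : 0 < n) (hk : 2 ≤ k)
    (K : AbstractSimplicialComplex (Fin n)) {x : Fin k → unitInterval} (hx : ∀ i, x i ≠ 1) :
    (ofComplex K).toFun k x = simplexIndicator K fun i => cellIndex n hn (x i) := by
  classical
  refine if_congr ?_ rfl rfl
  rw [or_iff_right (by omega)]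
  constructor
  · rintro ⟨j, hj, hK, hc⟩
    have : (fun i => cellIndex n hn (x i)) = j := funext fun i => cellIndex_of_mem_cell hn (hc i)
    rw [this]
    exact ⟨hj, hK⟩
  · rintro ⟨hj, hK⟩
    exact ⟨_, hj, hK, fun i => mem_cell_cellIndex hn (hx i)⟩

theorem abs_faceted_sub_le (U W : Complexon) {k : ℕ} (x y : Fin k → unitInterval) :
    |U.faceted.toFun k x - W.faceted.toFun k y| ≤ ∑ σ, |U.onFace x σ - W.onFace y σ| :=
  abs_prod_sub_prod_le Finset.univ _ _ (fun σ _ => U.onFace_mem_Icc x σ) fun σ _ => W.onFace_mem_Icc y σ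

theorem integrable_toFun (W : Complexon) (k : ℕ) (μ : Measure (Fin k → unitInterval))
    [IsFiniteMeasure μ] : Integrable (W.toFun k) μ :=
  Integrable.of_bound (W.measurable' k).aestronglyMeasurable 1 <| Filter.Eventually.of_forall fun x => by
    rw [Real.norm_of_nonneg (W.mem_Icc' k x).1]
    exact (W.mem_Icc' k x).2

theorem abs_setIntegral_le_of_bound {k : ℕ} (S : Set (Fin k → unitInterval)) (g : (Fin k → unitInterval) → ℝ)
    {C : ℝ} (hg : ∀ x, |g x| ≤ C) : |∫ x in S, g x| ≤ C := by
  have hC : 0 ≤ C := (abs_nonneg _).trans (hg fun _ => 0)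
  have := norm_setIntegral_le_of_norm_le_const (μ := volume) (s := S) (C := C) (f := g)
    (measure_lt_top _ _) (fun x _ => hg x)
  exact this.trans (mul_le_of_le_one_right hC measureReal_le_one)

/-- If `W` oscillates by at most `δ` at the scale `1/m`, the complex built from the values of `W` at
the points `a/m` is close to `∂W` in the labeled cut-distance. -/
theorem abs_setIntegral_faceted_sub_formComplex_le (W : Complexon) {m n q r k : ℕ} [Fact q.Prime]
    (hk : 2 ≤ k) (hm : 0 < m) (pt : Fin m → unitInterval) (hpt : ∀ a, (pt a : ℝ) = a / m)
    (e : Fin m × (Fin r → ZMod q) ≃ Fin n) (he : ∀ u, ((e.symm u).1 : ℕ) = u / q ^ r) {δ : ℝ}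
    (hq : 1 / (q : ℝ) ≤ δ) (hr : (k : ℝ) ^ 2 / q ^ r ≤ δ) (hδ : FormsEquidistributed q r k δ)
    (hW : ∀ l ≤ k, ∀ x y : Fin l → unitInterval, (∀ i, |(x i : ℝ) - y i| ≤ 1 / m) →
      |W.toFun l x - W.toFun l y| ≤ δ)
    (S : Fin k → Set unitInterval) :
    |∫ x in Set.univ.pi S, (W.faceted.toFun k x - (ofComplex (W.formComplex pt e)).faceted.toFun k x)| ≤
      (2 * 2 ^ k + 2) * δ := by
  classical
  have hcard : n = m * q ^ r := by
    have := Fintype.card_congr e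
    simp only [Fintype.card_prod, Fintype.card_fin, Fintype.card_fun, ZMod.card] at this
    exact this.symm
  have hq0 : 0 < q := (Fact.out : q.Prime).pos
  have hL : 0 < q ^ r := by positivity
  have hn : 0 < n := by rw [hcard]; positivity
  have hnR : (0 : ℝ) < n := by exact_mod_cast hn
  have hmR : (0 : ℝ) < m := by exact_mod_cast hm
  rw [faceted_ofComplex]
  set K := W.formComplex pt e with hK
  set F : (Fin k → Fin n) → ℝ := fun j => W.faceted.toFun k (fun i => pt (e.symm (j i)).1) with hF
  have hmeas : Measurable fun (x : Fin k → unitInterval) i => cellIndex n hn (x i) :=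
    measurable_pi_lambda _ fun i => (measurable_cellIndex hn).comp (measurable_pi_apply i)
  have hint : ∀ G : (Fin k → Fin n) → ℝ, Integrable (fun x : Fin k → unitInterval =>
      G fun i => cellIndex n hn (x i)) (volume.restrict (Set.univ.pi S)) := by
    intro G
    refine Integrable.of_bound ((measurable_of_countable G).comp hmeas).aestronglyMeasurable
      (∑ j, |G j|) (Filter.Eventually.of_forall fun x => ?_)
    exact Finset.single_le_sum (f := fun j => |G j|) (fun j _ => abs_nonneg _) (Finset.mem_univ _)
  -- By `he` the vertices are listed block by block, so each cell of length `1/n` lies in the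
  -- interval of length `1/m` starting at the point of its block.
  have hclose : ∀ x : unitInterval, |(x : ℝ) - pt (e.symm (cellIndex n hn x)).1| ≤ 1 / m := by
    intro x
    obtain ⟨h1, h2⟩ := cellIndex_bounds hn x
    set u : ℕ := (cellIndex n hn x : ℕ) with hu
    set t : ℕ := u / q ^ r with ht
    have ha : t * q ^ r ≤ u := Nat.div_mul_le_self _ _
    have hb : u + 1 ≤ (t + 1) * q ^ r := by
      have := Nat.lt_div_mul_add (a := u) hL
      rw [add_mul, one_mul]
      exact this
    have ha' : (t : ℝ) * q ^ r ≤ u := by exact_mod_cast ha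
    have hb' : (u : ℝ) + 1 ≤ (t + 1) * q ^ r := by exact_mod_cast hb
    have hLR : (0 : ℝ) < q ^ r := by exact_mod_cast hL
    have hnL : (n : ℝ) = m * q ^ r := by exact_mod_cast hcard
    rw [hnL, ← mul_assoc] at h1 h2
    have h3 : (t : ℝ) ≤ x * m := le_of_mul_le_mul_right (ha'.trans h1) hLR
    have h4 : (x : ℝ) * m ≤ t + 1 := le_of_mul_le_mul_right (h2.trans hb') hLR
    have h5 : (t : ℝ) / m ≤ x := (div_le_iff₀ hmR).2 h3
    have h6 : (x : ℝ) ≤ (t + 1) / m := (le_div_iff₀ hmR).2 h4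
    rw [hpt, he, abs_of_nonneg (sub_nonneg.2 h5)]
    rw [add_div] at h6
    linarith
  have h1 : |∫ x in Set.univ.pi S, (W.faceted.toFun k x - F fun i => cellIndex n hn (x i))| ≤
      2 ^ k * δ := by
    refine abs_setIntegral_le_of_bound _ _ fun x => ?_
    refine (abs_faceted_sub_le W W _ _).trans
      ((Finset.sum_le_sum (g := fun _ => δ) fun σ _ => ?_).trans ?_)
    · exact hW _ (by simpa using Finset.card_le_univ σ) _ _ fun i => hclose _
    · simp
  have h2 : |∫ x in Set.univ.pi S, (F (fun i => cellIndex n hn (x i)) -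
      simplexIndicator K fun i => cellIndex n hn (x i))| ≤ (2 ^ k + 2) * δ := by
    -- Scaling by `n` brings the weights into `[0,1]`; the resulting factor `n ^ k` is the
    -- normalisation in the counting bound.
    set f : Fin k → Fin n → ℝ :=
      fun i u => n * volume.real (S i ∩ cellIndex n hn ⁻¹' {u}) with hf
    have hfmem : ∀ i u, f i u ∈ Set.Icc (0 : ℝ) 1 := by
      intro i u
      refine ⟨mul_nonneg hnR.le measureReal_nonneg, ?_⟩
      have := (measure_mono (Set.inter_subset_right (s := S i))).trans
        (volume_cellIndex_preimage_le hn u)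
      have h' : volume.real (S i ∩ cellIndex n hn ⁻¹' {u}) ≤ 1 / n :=
        ENNReal.toReal_le_of_le_ofReal (by positivity) this
      calc _ ≤ (n : ℝ) * (1 / n) := mul_le_mul_of_nonneg_left h' hnR.le
        _ = 1 := by field_simp
    have hsum := abs_sum_sub_simplexIndicator_le W (by omega) pt e hq hr hδ f hfmem
    rw [setIntegral_comp_cellIndex hn S (fun j => F j - simplexIndicator K j)]
    have hnk : (0 : ℝ) < (n : ℝ) ^ k := by positivity
    refine le_of_mul_le_mul_right (le_trans (le_of_eq ?_) hsum) hnk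
    rw [← abs_of_pos hnk, ← abs_mul, Finset.sum_mul]
    congr 1
    refine Finset.sum_congr rfl fun j _ => ?_
    simp only [hf, Finset.prod_mul_distrib, Finset.prod_const, Finset.card_univ, Fintype.card_fin]
    ring
  have h3 : ∫ x in Set.univ.pi S, (W.faceted.toFun k x - (ofComplex K).toFun k x) =
      (∫ x in Set.univ.pi S, (W.faceted.toFun k x - F fun i => cellIndex n hn (x i))) +
      ∫ x in Set.univ.pi S, (F (fun i => cellIndex n hn (x i)) -
        simplexIndicator K fun i => cellIndex n hn (x i)) := by
    refine Eq.trans ?_ (integral_add ((W.faceted.integrable_toFun k _).sub (hint F))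
      ((hint F).sub (hint (simplexIndicator K))))
    refine integral_congr_ae ?_
    filter_upwards [ae_restrict_of_ae (ae_forall_ne_one k)] with x hx
    simp only [ofComplex_eq_simplexIndicator hn hk K hx]
    ring
  rw [h3]
  refine (abs_add_le _ _).trans ((add_le_add h1 h2).trans (le_of_eq ?_))
  ring

end Complexon

/-! ### Approximation by continuous complexons in `L¹`. -/

theorem measurePreserving_comp_injective {ι κ : Type*} [Fintype ι] [Fintype κ] {X : Type*}
    [MeasureSpace X] [IsProbabilityMeasure (volume : Measure X)] {e : ι → κ}
    (he : Function.Injective e) :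
    MeasurePreserving (fun (x : κ → X) i => x (e i)) volume volume := by
  have hm : Measurable fun (x : κ → X) i => x (e i) :=
    measurable_pi_lambda _ fun i => measurable_pi_apply (e i)
  refine ⟨hm, ?_⟩
  rw [volume_pi, volume_pi]
  refine (Measure.pi_eq fun s hs => ?_).symm
  rw [Measure.map_apply hm (MeasurableSet.univ_pi hs)]
  have hpre : (fun (x : κ → X) i => x (e i)) ⁻¹' Set.univ.pi s =
      Set.univ.pi (Function.extend e s fun _ => Set.univ) := by
    ext x
    simp only [Set.mem_preimage, Set.mem_univ_pi]
    constructor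
    · intro h u
      by_cases hu : ∃ i, e i = u
      · obtain ⟨i, rfl⟩ := hu
        rw [he.extend_apply]
        exact h i
      · rw [Function.extend_apply' _ _ _ hu]
        trivial
    · intro h i
      have := h (e i)
      rwa [he.extend_apply] at this
  rw [hpre, Measure.pi_pi]
  refine (Fintype.prod_of_injective e he _ _ (fun u hu => ?_) fun i => ?_).symm
  · rw [Function.extend_apply' _ _ _ (by simpa using hu), measure_univ]
  · rw [he.extend_apply]

namespace Complexon

theorem integral_comp_injective {ι κ : Type*} [Fintype ι] [Fintype κ] {e : ι → κ}
    (he : Function.Injective e) {g : (ι → unitInterval) → ℝ} (hg : Measurable g) :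
    ∫ x : κ → unitInterval, g (fun i => x (e i)) = ∫ y, g y := by
  have h := measurePreserving_comp_injective (X := unitInterval) he
  rw [← h.map_eq, integral_map h.measurable.aemeasurable hg.aestronglyMeasurable]

theorem integrable_abs_sub (U W : Complexon) (k : ℕ) (μ : Measure (Fin k → unitInterval))
    [IsFiniteMeasure μ] : Integrable (fun x => |U.toFun k x - W.toFun k x|) μ :=
  ((U.integrable_toFun k μ).sub (W.integrable_toFun k μ)).abs

/-- Bounded continuous functions are dense in `L¹`. Clamping to `[0,1]` and averaging over
permutations do not increase the error, because `W` already takes values in `[0,1]` and is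
symmetric. -/
theorem exists_continuous_symmetric (W : Complexon) (k : ℕ) {ε : ℝ} (hε : 0 < ε) :
    ∃ g : (Fin k → unitInterval) → ℝ, Continuous g ∧ (∀ x, g x ∈ Set.Icc (0 : ℝ) 1) ∧
      (∀ (π : Equiv.Perm (Fin k)) x, g (x ∘ π) = g x) ∧ ∫ x, |W.toFun k x - g x| ≤ ε := by
  obtain ⟨f, hf, -⟩ := (W.integrable_toFun k volume).exists_boundedContinuous_integral_sub_le hε
  set c : (Fin k → unitInterval) → ℝ := fun x => max (min (f x) 1) 0 with hc
  have hcc : Continuous c := (f.continuous.min continuous_const).max continuous_const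
  have hc01 : ∀ x, c x ∈ Set.Icc (0 : ℝ) 1 := fun x =>
    ⟨le_max_right _ _, max_le (min_le_right _ _) zero_le_one⟩
  have hcabs : ∀ x, |W.toFun k x - c x| ≤ |W.toFun k x - f x| := by
    intro x
    obtain ⟨h0, h1⟩ := W.mem_Icc' k x
    have e : W.toFun k x = max (min (W.toFun k x) 1) 0 := by
      rw [min_eq_left h1, max_eq_left h0]
    calc |W.toFun k x - c x| = |max (min (W.toFun k x) 1) 0 - max (min (f x) 1) 0| := by
          rw [← e]
      _ ≤ |min (W.toFun k x) 1 - min (f x) 1| := abs_max_sub_max_le_abs _ _ _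
      _ ≤ max |W.toFun k x - f x| |(1 : ℝ) - 1| := abs_min_sub_min_le_max _ _ _ _
      _ = _ := by simp
  have hfint : Integrable (fun x => |W.toFun k x - f x|) :=
    ((W.integrable_toFun k volume).sub (f.integrable volume)).abs
  have hcmeas : Measurable fun x => |W.toFun k x - c x| :=
    ((W.measurable' k).sub hcc.measurable).abs
  have hcint : Integrable (fun x => |W.toFun k x - c x|) :=
    hfint.mono' hcmeas.aestronglyMeasurable (Filter.Eventually.of_forall fun x => by
      rw [Real.norm_eq_abs, abs_abs]; exact hcabs x)
  have hcle : ∫ x, |W.toFun k x - c x| ≤ ε :=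
    (integral_mono hcint hfint hcabs).trans hf
  set N : ℝ := (Fintype.card (Equiv.Perm (Fin k)) : ℝ) with hN
  have hN0 : 0 < N := by
    rw [hN]
    exact_mod_cast Fintype.card_pos
  refine ⟨fun x => (∑ π : Equiv.Perm (Fin k), c (x ∘ π)) / N, ?_, ?_, ?_, ?_⟩
  · refine Continuous.div_const (continuous_finsetSum _ fun π _ => hcc.comp ?_) _
    exact continuous_pi fun i => continuous_apply (π i)
  · intro x
    refine ⟨div_nonneg (Finset.sum_nonneg fun π _ => (hc01 _).1) hN0.le, (div_le_one hN0).2 ?_⟩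
    refine (Finset.sum_le_sum fun π _ => (hc01 _).2).trans ?_
    simp [hN]
  · intro ρ x
    simp only
    congr 1
    exact Fintype.sum_equiv (Equiv.mulLeft ρ) _ _ fun π => rfl
  · have hint : ∀ π : Equiv.Perm (Fin k),
        Integrable fun x : Fin k → unitInterval => |W.toFun k (x ∘ π) - c (x ∘ π)| := fun π =>
      (measurePreserving_comp_injective (X := unitInterval) π.injective).integrable_comp_of_integrable
        hcint
    have hbound : ∀ x, |W.toFun k x - (∑ π : Equiv.Perm (Fin k), c (x ∘ π)) / N| ≤
        (∑ π : Equiv.Perm (Fin k), |W.toFun k (x ∘ π) - c (x ∘ π)|) / N := by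
      intro x
      have e : W.toFun k x - (∑ π : Equiv.Perm (Fin k), c (x ∘ π)) / N =
          (∑ π : Equiv.Perm (Fin k), (W.toFun k (x ∘ π) - c (x ∘ π))) / N := by
        simp only [W.symm', Finset.sum_sub_distrib, Finset.sum_const, Finset.card_univ, nsmul_eq_mul]
        rw [← hN]
        field_simp
      rw [e, abs_div, abs_of_pos hN0]
      exact div_le_div_of_nonneg_right (Finset.abs_sum_le_sum_abs _ _) hN0.le
    have hsumint := (integrable_finsetSum Finset.univ fun π _ => hint π).div_const N
    refine (integral_mono_of_nonneg (Filter.Eventually.of_forall fun x => abs_nonneg _) hsumint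
      (Filter.Eventually.of_forall hbound)).trans ?_
    rw [integral_div, integral_finsetSum _ fun π _ => hint π, div_le_iff₀ hN0]
    refine (Finset.sum_le_sum (g := fun _ => ε) fun π _ => ?_).trans ?_
    · exact (integral_comp_injective π.injective hcmeas).trans_le hcle
    · simp [hN, mul_comm]

/-- No compatibility links the different dimensions of a complexon, so they are approximated
independently. -/
theorem exists_continuous_complexon (W : Complexon) {ε : ℝ} (hε : 0 < ε) :
    ∃ W' : Complexon, (∀ k, Continuous (W'.toFun k)) ∧
      ∀ k, ∫ x, |W.toFun k x - W'.toFun k x| ≤ ε := by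
  choose g hg hg01 hgsymm hgε using fun k => W.exists_continuous_symmetric k hε
  refine ⟨{ toFun := fun k x => if k ≤ 1 then 1 else g k x
            measurable' := ?_
            mem_Icc' := ?_
            symm' := ?_
            eq_one' := fun k hk x => if_pos hk }, ?_, ?_⟩
  · intro k
    split_ifs
    · exact measurable_const
    · exact (hg k).measurable
  · intro k x
    split_ifs
    · simp
    · exact hg01 k x
  · intro k π x
    split_ifs
    · rfl
    · exact hgsymm k π x
  · intro k
    by_cases hk : k ≤ 1
    · simpa [hk] using continuous_const
    · simpa [hk] using hg k
  · intro k
    by_cases hk : k ≤ 1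
    · simp only [hk, if_true, W.eq_one' k hk, sub_self, abs_zero, integral_zero]
      exact hε.le
    · simpa [hk] using hgε k

/-- Each of the `2 ^ k` faces contributes at most `ε`, since projection to the coordinates of a face
preserves volume. -/
theorem abs_setIntegral_faceted_sub_le (U W : Complexon) {k : ℕ} {ε : ℝ}
    (h : ∀ l, ∫ x, |U.toFun l x - W.toFun l x| ≤ ε) (S : Set (Fin k → unitInterval)) :
    |∫ x in S, (U.faceted.toFun k x - W.faceted.toFun k x)| ≤ 2 ^ k * ε := by
  have hint : ∀ σ : Finset (Fin k), Integrable fun x => |U.onFace x σ - W.onFace x σ| := fun σ =>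
    (measurePreserving_comp_injective (X := unitInterval)
      (σ.orderEmbOfFin rfl).injective).integrable_comp_of_integrable (U.integrable_abs_sub W _ _)
  calc |∫ x in S, (U.faceted.toFun k x - W.faceted.toFun k x)|
      ≤ ∫ x in S, |U.faceted.toFun k x - W.faceted.toFun k x| := abs_integral_le_integral_abs
    _ ≤ ∫ x, |U.faceted.toFun k x - W.faceted.toFun k x| :=
        setIntegral_le_integral (U.faceted.integrable_abs_sub W.faceted k _)
          (Filter.Eventually.of_forall fun x => abs_nonneg _)
    _ ≤ ∫ x, ∑ σ, |U.onFace x σ - W.onFace x σ| :=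
        integral_mono (U.faceted.integrable_abs_sub W.faceted k _)
          (integrable_finsetSum _ fun σ _ => hint σ) fun x => U.abs_faceted_sub_le W x x
    _ = ∑ σ, ∫ x, |U.onFace x σ - W.onFace x σ| := integral_finsetSum _ fun σ _ => hint σ
    _ ≤ ∑ σ : Finset (Fin k), ε := Finset.sum_le_sum fun σ _ =>
        (integral_comp_injective (σ.orderEmbOfFin rfl).injective
          (((U.measurable' _).sub (W.measurable' _)).abs)).trans_le (h _)
    _ = _ := by simp

/-! ### Reduction of the canonical distance to finitely many labeled cut-distances. -/

theorem cutDistDim_nonneg (d : ℕ) (U W : Complexon) : 0 ≤ cutDistDim d U W :=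
  Real.iSup_nonneg fun _ => abs_nonneg _

theorem cutDistDim_le_one (d : ℕ) (U W : Complexon) : cutDistDim d U W ≤ 1 := by
  refine Real.iSup_le (fun S => abs_setIntegral_le_of_bound _ _ fun x => ?_) zero_le_one
  have hU := U.mem_Icc' (d + 1) x
  have hW := W.mem_Icc' (d + 1) x
  exact abs_le.2 ⟨by linarith [hU.1, hW.2], by linarith [hU.2, hW.1]⟩

/-- Each dimension has distance at most `1`, so the dimensions beyond `D` contribute no more than a
tail of the summable weights. -/
theorem exists_cutDist_lt {α : ℕ → ℝ} (hα : ∀ j : ℕ, 1 ≤ j → 0 < α j) (hsum : Summable α) {ε : ℝ}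
    (hε : 0 < ε) : ∃ D : ℕ, ∃ η > 0, ∀ U W : Complexon,
      (∀ j < D, cutDistDim (j + 1) U W ≤ η) → cutDist α U W < ε := by
  have hβ : Summable fun j => α (j + 1) := (summable_nat_add_iff 1).2 hsum
  have hβ0 : ∀ j, 0 ≤ α (j + 1) := fun j => (hα _ (by omega)).le
  obtain ⟨D, hD⟩ := ((tendsto_sum_nat_add fun j => α (j + 1)).eventually
    (gt_mem_nhds (half_pos hε))).exists
  set B := ∑' j, α (j + 1) with hB
  have hB0 : 0 ≤ B := tsum_nonneg hβ0
  -- Half of `ε` is kept for the tail; `B + 1` bounds the total weight and is visibly positive.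
  refine ⟨D, ε / 2 / (B + 1), by positivity, fun U W h => ?_⟩
  have hle : ∀ j, α (j + 1) * cutDistDim (j + 1) U W ≤ α (j + 1) := fun j =>
    mul_le_of_le_one_right (hβ0 j) (cutDistDim_le_one _ _ _)
  have hs : Summable fun j => α (j + 1) * cutDistDim (j + 1) U W :=
    Summable.of_nonneg_of_le (fun j => mul_nonneg (hβ0 j) (cutDistDim_nonneg _ _ _)) hle hβ
  rw [cutDist, ← hs.sum_add_tsum_nat_add D]
  have h1 : ∑ j ∈ Finset.range D, α (j + 1) * cutDistDim (j + 1) U W ≤ ε / 2 := by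
    calc _ ≤ ∑ j ∈ Finset.range D, α (j + 1) * (ε / 2 / (B + 1)) :=
          Finset.sum_le_sum fun j hj =>
            mul_le_mul_of_nonneg_left (h j (Finset.mem_range.1 hj)) (hβ0 j)
      _ = (∑ j ∈ Finset.range D, α (j + 1)) * (ε / 2 / (B + 1)) := by rw [Finset.sum_mul]
      _ ≤ (B + 1) * (ε / 2 / (B + 1)) := by
          refine mul_le_mul_of_nonneg_right ?_ (by positivity)
          have := hβ.sum_le_tsum (Finset.range D) fun j _ => hβ0 j
          linarith
      _ = _ := by field_simp
  have h2 : ∑' j, α (j + D + 1) * cutDistDim (j + D + 1) U W ≤ ∑' j, α (j + D + 1) :=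
    ((summable_nat_add_iff D).2 hs).tsum_le_tsum (fun j => hle _) ((summable_nat_add_iff D).2 hβ)
  linarith

/-- The identity is one of the maps in the infimum. -/
theorem canonicalDist_le_cutDist {α : ℕ → ℝ} (hα : ∀ j : ℕ, 1 ≤ j → 0 < α j) (U W : Complexon) :
    canonicalDist α U W ≤ cutDist α U.faceted W.faceted := by
  have hbdd : BddBelow (Set.range fun φ : {φ : unitInterval → unitInterval //
      MeasurePreserving φ volume volume} =>
      cutDist α U.faceted (W.faceted.pullback φ.1 φ.2.measurable)) := by
    refine ⟨0, ?_⟩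
    rintro _ ⟨φ, rfl⟩
    exact tsum_nonneg fun j => mul_nonneg (hα _ (by omega)).le (cutDistDim_nonneg _ _ _)
  exact ciInf_le hbdd ⟨id, MeasurePreserving.id _⟩

/-! ### Choice of the parameters and density. -/

theorem eventually_oscillation_le {k : ℕ} {g : (Fin k → unitInterval) → ℝ} (hg : Continuous g)
    {δ : ℝ} (hδ : 0 < δ) : ∀ᶠ m : ℕ in Filter.atTop, ∀ x y : Fin k → unitInterval,
      (∀ i, |(x i : ℝ) - y i| ≤ 1 / m) → |g x - g y| ≤ δ := by
  obtain ⟨ρ, hρ, h⟩ := Metric.uniformContinuous_iff.1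
    (CompactSpace.uniformContinuous_of_continuous hg) δ hδ
  filter_upwards [(tendsto_one_div_atTop_nhds_zero_nat (𝕜 := ℝ)).eventually (gt_mem_nhds hρ)]
    with m hm x y hxy
  exact (h ((dist_pi_lt_iff hρ).2 fun i => (hxy i).trans_lt hm)).le

theorem eventually_formsEquidistributed (q k : ℕ) [Fact q.Prime] {δ : ℝ} (hδ : 0 < δ) :
    ∀ᶠ r : ℕ in Filter.atTop, FormsEquidistributed q r k δ ∧ (k : ℝ) ^ 2 / q ^ r ≤ δ := by
  obtain ⟨R, hR⟩ := exists_abs_sum_form_sub_le q (Fin k) hδ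
  have hq : (1 : ℝ) < q := by exact_mod_cast (Fact.out : q.Prime).one_lt
  have ht : Filter.Tendsto (fun r : ℕ => (k : ℝ) ^ 2 / q ^ r) Filter.atTop (nhds 0) :=
    Filter.Tendsto.div_atTop tendsto_const_nhds (tendsto_pow_atTop_atTop_of_one_lt hq)
  filter_upwards [Filter.eventually_ge_atTop R, ht.eventually (ge_mem_nhds hδ)] with r hr hk
  refine ⟨fun h hh h1 f hf => ?_, hk⟩
  simpa using hR r hr h hh h1 f hf

/-- The order of choice matters: `m` from the oscillation of `W`, the prime `q` from the rounding
error, and only then `r`, whose threshold depends on `q`. -/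
theorem exists_formComplex_close (W : Complexon) (hW : ∀ k, Continuous (W.toFun k)) (D : ℕ) {δ : ℝ}
    (hδ : 0 < δ) : ∃ n : ℕ, 1 ≤ n ∧ ∃ K : AbstractSimplicialComplex (Fin n), ∀ k, 2 ≤ k → k ≤ D →
      ∀ S : Fin k → Set unitInterval,
        |∫ x in Set.univ.pi S, (W.faceted.toFun k x - (ofComplex K).faceted.toFun k x)| ≤
          (2 * 2 ^ k + 2) * δ := by
  obtain ⟨m, hm, hm0⟩ := ((((Finset.range (D + 1)).eventually_all).2 fun k _ =>
    eventually_oscillation_le (hW k) hδ).and (Filter.eventually_gt_atTop 0)).exists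
  obtain ⟨q, hqδ, hqp⟩ := Nat.exists_infinite_primes (⌈1 / δ⌉₊ + 1)
  have : Fact q.Prime := ⟨hqp⟩
  have hq : 1 / (q : ℝ) ≤ δ := by
    have h1 : 1 / δ ≤ q := (Nat.le_ceil _).trans (by exact_mod_cast (Nat.le_succ _).trans hqδ)
    rw [div_le_iff₀ hδ] at h1
    rw [div_le_iff₀ (by exact_mod_cast hqp.pos)]
    linarith
  obtain ⟨r, hr⟩ := (((Finset.range (D + 1)).eventually_all).2 fun k _ =>
    eventually_formsEquidistributed q k hδ).exists
  have hmR : (0 : ℝ) < m := by exact_mod_cast hm0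
  have hcard : Fintype.card (Fin r → ZMod q) = q ^ r := by simp [ZMod.card]
  let e : Fin m × (Fin r → ZMod q) ≃ Fin (m * q ^ r) :=
    ((Equiv.refl _).prodCongr (Fintype.equivFinOfCardEq hcard)).trans finProdFinEquiv
  let pt : Fin m → unitInterval := fun a => ⟨(a : ℝ) / m, by positivity,
    (div_le_one hmR).2 (by exact_mod_cast a.2.le)⟩
  refine ⟨m * q ^ r, Nat.mul_pos hm0 (pow_pos hqp.pos r), W.formComplex pt e, fun k hk2 hkD S => ?_⟩
  have hkr := hr k (Finset.mem_range.2 (by omega))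
  exact W.abs_setIntegral_faceted_sub_formComplex_le hk2 hm0 pt (fun a => rfl) e (fun u => rfl) hq
    hkr.2 hkr.1 (fun l hl => hm l (Finset.mem_range.2 (by omega))) S

theorem exists_canonicalDist_lt {α : ℕ → ℝ} (hα : ∀ j : ℕ, 1 ≤ j → 0 < α j) (hsum : Summable α)
    (W : Complexon) {ε : ℝ} (hε : 0 < ε) : ∃ V ∈ simplicial, canonicalDist α W V < ε := by
  obtain ⟨D, η, hη, hD⟩ := exists_cutDist_lt hα hsum hε
  obtain ⟨W', hcont, hW'⟩ := W.exists_continuous_complexon (ε := η / 2 / 2 ^ (D + 1)) (by positivity)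
  obtain ⟨n, hn, K, hK⟩ := W'.exists_formComplex_close hcont (D + 1)
    (δ := η / 2 / (2 * 2 ^ (D + 1) + 2)) (by positivity)
  refine ⟨ofComplex K, ⟨n, hn, K, rfl⟩, (canonicalDist_le_cutDist hα _ _).trans_lt (hD _ _ ?_)⟩
  intro j hj
  refine Real.iSup_le (fun S => ?_) hη.le
  -- Dimension `j + 1` lives on tuples of length `j + 2`, and `j < D`, so lengths up to `D + 1`
  -- suffice. The two approximations receive `η / 2` each.
  have hpow : (2 : ℝ) ^ (j + 1 + 1) ≤ 2 ^ (D + 1) := pow_le_pow_right₀ one_le_two (by omega)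
  have h1 := abs_setIntegral_faceted_sub_le W W' hW' (Set.univ.pi S.1)
  have h2 := hK (j + 1 + 1) (by omega) (by omega) S.1
  have h1' : (2 : ℝ) ^ (j + 1 + 1) * (η / 2 / 2 ^ (D + 1)) ≤ η / 2 := by
    rw [mul_div_assoc', div_le_iff₀ (by positivity), mul_comm]
    gcongr
  have h2' : (2 * (2 : ℝ) ^ (j + 1 + 1) + 2) * (η / 2 / (2 * 2 ^ (D + 1) + 2)) ≤ η / 2 := by
    rw [mul_div_assoc', div_le_iff₀ (by positivity), mul_comm]
    gcongr
  have e : ∫ x in Set.univ.pi S.1, (W.faceted.toFun (j + 1 + 1) x -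
      (ofComplex K).faceted.toFun (j + 1 + 1) x) =
      (∫ x in Set.univ.pi S.1, (W.faceted.toFun (j + 1 + 1) x - W'.faceted.toFun (j + 1 + 1) x)) +
      ∫ x in Set.univ.pi S.1, (W'.faceted.toFun (j + 1 + 1) x -
        (ofComplex K).faceted.toFun (j + 1 + 1) x) := by
    refine Eq.trans ?_ (integral_add
      ((W.faceted.integrable_toFun _ _).sub (W'.faceted.integrable_toFun _ _))
      ((W'.faceted.integrable_toFun _ _).sub ((ofComplex K).faceted.integrable_toFun _ _)))
    refine integral_congr_ae (Filter.Eventually.of_forall fun x => ?_)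
    simp
  rw [e]
  exact (abs_add_le _ _).trans (by linarith)

end Complexon

theorem mainTheorem7 (α : ℕ → ℝ) (hα : ∀ j : ℕ, 1 ≤ j → 0 < α j) (hsum : Summable α) :
    @Dense Complexon (Complexon.canonicalTopology α) Complexon.simplicial := by
  let _ : TopologicalSpace Complexon := Complexon.canonicalTopology α
  intro W
  rw [mem_closure_iff]
  intro O hO hWO
  obtain ⟨ε, hε, h⟩ := hO W hWO
  obtain ⟨V, hV, hlt⟩ := Complexon.exists_canonicalDist_lt hα hsum W hε
  exact ⟨V, h V hlt, hV⟩
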